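/- **Two-party model.** Let $\mathcal X$ be a finite set. Parties $A$ and $B$ hold $X\in\mathcal X^n$ and $Y\in\mathcal X^n$ and run a randomized protocol $P$: each party has private randomness, independent of that of the other party, and they alternately send messages, a finite number in total, each a function of the sender's input, the sender's private randomness and the previous messages. The view of a party is the tuple consisting of its input, its private randomness and the transcript of all messages. Datasets are neighbouring if they differ in a single coordinate. A randomized algorithm $M$ is $(\varepsilon,\delta)$-DP if $\Pr[M(D)\in S]\le e^{\varepsilon}\Pr[M(D')\in S]+\delta$ for all neighbouring $D,D'$ and all events $S$. The protocol $P$ is $(\varepsilon,\delta)$-two-party DP if, for every fixed $X$, the map $Y\mapsto \mathrm{VIEW}^A_P(X,Y)$ is $(\varepsilon,\delta)$-DP and, for every fixed $Y$, the map $X\mapsto\mathrm{VIEW}^B_P(X,Y)$ is $(\varepsilon,\delta)$-DP. It computes $f:\mathcal X^{2n}\to\mathbb R$ with error $\beta$ if one of the two parties can output, as a function of its view, a number that for all inputs $X,Y$ lies in $[f(X,Y)-\beta,f(X,Y)+\beta]$ with probability at least $0.9$. The global sensitivity of $f$ is the supremum of $|f(D)-f(D')|$ over neighbouring $D,D'\in\mathcal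 X^{2n}$. **Theorem.** Let $\varepsilon_0\ge 0$. (1) There are constants $c_1,c_2>0$ and $N$, depending only on $\varepsilon_0$, such that for every $n\ge N$ there is a function $f:\{0,1\}^{2n}\to\mathbb R$ of global sensitivity exactly $1$, of the form $$f(x_1,\dots,x_n,y_1,\dots,y_n)=\sum_{i=1}^{\lfloor n/D\rfloor}\Bigl(\sum_{\ell=1}^{D}x_{(i-1)D+\ell}\,y_{(i-1)D+\ell}\bmod 2\Bigr)$$ for some integer $D\ge1$ (the outer sum is over the integers), such that for all $0\le\varepsilon\le\varepsilon_0$ and $0\le\delta\le c_1/n$, no $(\varepsilon,\delta)$-two-party DP protocol computes $f$ with error at most $c_2\,n/\log n$. In particular, no $(\varepsilon,o(1/n))$-two-party DP protocol with $\varepsilon=O(1)$ computes $f$ within error $o(n/\log n)$. (2) The same holds for symmetric functions over a larger domain: there are constants $c_1,c_2>0$ and $N$, depending only on $\varepsilon_0$, such that for every $n\ge N$ there is a function $f:[2n]^{2n}\to\mathbb R$ that is symmetric (invariant under all permutations of its $2n$ arguments) and has global sensitivity exactly $1$, such that for all $0\le\varepsilon\le\varepsilon_0$ and $0\le\delta\le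 c_1/n$, no $(\varepsilon,\delta)$-two-party DP protocol computes $f$ with error at most $c_2\,n/\log n$. -/

import Mathlib

open MeasureTheory

namespace TwoPartyDP

/-- Two datasets are neighbouring if they differ in (at most) one coordinate. -/
def Neighbouring {ι 𝒳 : Type} (D D' : ι → 𝒳) : Prop :=
  ∃ i, ∀ j, j ≠ i → D j = D' j

/-- The global sensitivity of `f` is `s`: the supremum of `|f D - f D'|` over all pairs of
neighbouring datasets exists and equals `s`. -/
def HasSensitivity {ι 𝒳 : Type} (f : (ι → 𝒳) → ℝ) (s : ℝ) : Prop :=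
  IsLUB {d : ℝ | ∃ D D' : ι → 𝒳, Neighbouring D D' ∧ d = |f D - f D'|} s

/-- `f` is symmetric: it is invariant under every permutation of its arguments. -/
def IsSymmetric {ι 𝒳 : Type} (f : (ι → 𝒳) → ℝ) : Prop :=
  ∀ (σ : Equiv.Perm ι) (w : ι → 𝒳), f (w ∘ σ) = f w

/-- The randomized algorithm `M`, with random seed distributed according to `μ`, is
`(ε, δ)`-differentially private. -/
def IsDP {ι 𝒳 Ω Z : Type} [MeasurableSpace Ω] [MeasurableSpace Z] (μ : Measure Ω)
    (M : (ι → 𝒳) → Ω → Z) (ε δ : ℝ) : Prop :=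
  ∀ D D' : ι → 𝒳, Neighbouring D D' → ∀ S : Set Z, MeasurableSet S →
    μ.real {ω | M D ω ∈ S} ≤ Real.exp ε * μ.real {ω | M D' ω ∈ S} + δ

/-- A randomized two-party protocol in which each party holds `n` elements of `𝒳`.
Each party has private randomness (an arbitrary standard Borel probability space). The parties
alternately send a message from the message space `Msg` (an arbitrary standard Borel space), for
`rounds` messages in total; the message number `k` is a measurable function of the
input and the private randomness of its sender and of the `k` earlier messages. Party `A` sends the
messages number `0, 2, 4, …` and party `B` sends the messages number `1, 3, 5, …`. -/
structure Protocol (𝒳 : Type) (n : ℕ) where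
  CoinsA : Type
  CoinsB : Type
  Msg : Type
  [measurableSpaceA : MeasurableSpace CoinsA]
  [measurableSpaceB : MeasurableSpace CoinsB]
  [measurableSpaceMsg : MeasurableSpace Msg]
  [standardBorelA : StandardBorelSpace CoinsA]
  [standardBorelB : StandardBorelSpace CoinsB]
  [standardBorelMsg : StandardBorelSpace Msg]
  lawA : Measure CoinsA
  lawB : Measure CoinsB
  [isProbabilityMeasureA : IsProbabilityMeasure lawA]
  [isProbabilityMeasureB : IsProbabilityMeasure lawB]
  rounds : ℕ
  sendA : (k : ℕ) → (Fin n → 𝒳) → CoinsA → (Fin k → Msg) → Msg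
  sendB : (k : ℕ) → (Fin n → 𝒳) → CoinsB → (Fin k → Msg) → Msg
  measurable_sendA : ∀ k X, Measurable fun p : CoinsA × (Fin k → Msg) => sendA k X p.1 p.2
  measurable_sendB : ∀ k Y, Measurable fun p : CoinsB × (Fin k → Msg) => sendB k Y p.1 p.2

attribute [instance] Protocol.measurableSpaceA Protocol.measurableSpaceB
  Protocol.measurableSpaceMsg Protocol.standardBorelA Protocol.standardBorelB
  Protocol.standardBorelMsg Protocol.isProbabilityMeasureA Protocol.isProbabilityMeasureB

namespace Protocol

variable {𝒳 : Type} {n : ℕ} (P : Protocol 𝒳 n)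

/-- The private randomness of both parties together. -/
abbrev Coins : Type := P.CoinsA × P.CoinsB

/-- The private random seeds of the two parties are independent. -/
noncomputable def law : Measure P.Coins := P.lawA.prod P.lawB

/-- The first `k` messages on the inputs `X`, `Y` and the private random seeds `r`. -/
def messages (X Y : Fin n → 𝒳) (r : P.Coins) : (k : ℕ) → (Fin k → P.Msg)
  | 0 => Fin.elim0
  | k + 1 => Fin.snoc (α := fun _ => P.Msg) (messages X Y r k)
      (if Even k then P.sendA k X r.1 (messages X Y r k)
        else P.sendB k Y r.2 (messages X Y r k))

/-- The transcript: all messages of the protocol. -/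
def transcript (X Y : Fin n → 𝒳) (r : P.Coins) : Fin P.rounds → P.Msg :=
  P.messages X Y r P.rounds

/-- What `A` sees: its input, its private randomness, and the transcript. -/
abbrev ViewA : Type := (Fin n → 𝒳) × P.CoinsA × (Fin P.rounds → P.Msg)

/-- What `B` sees: its input, its private randomness, and the transcript. -/
abbrev ViewB : Type := (Fin n → 𝒳) × P.CoinsB × (Fin P.rounds → P.Msg)

/-- The view of `A` when the inputs are `X` and `Y`. -/
def viewA (X Y : Fin n → 𝒳) (r : P.Coins) : P.ViewA := (X, r.1, P.transcript X Y r)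

/-- The view of `B` when the inputs are `X` and `Y`. -/
def viewB (X Y : Fin n → 𝒳) (r : P.Coins) : P.ViewB := (Y, r.2, P.transcript X Y r)

/-- `P` is an `(ε, δ)`-two-party DP protocol: for every input `X` of `A`, the view of `A` is an
`(ε, δ)`-DP function of the input of `B`, and vice versa. -/
def IsTwoPartyDP [MeasurableSpace 𝒳] (ε δ : ℝ) : Prop :=
  (∀ X : Fin n → 𝒳, IsDP P.law (fun Y r => P.viewA X Y r) ε δ) ∧
  (∀ Y : Fin n → 𝒳, IsDP P.law (fun X r => P.viewB X Y r) ε δ)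

/-- `P` computes `f : 𝒳 ^ (2 n) → ℝ` with error `β`: one of the two parties can output, as a
function of its view, a number that on all inputs `X`, `Y` lies within `β` of `f (X, Y)` with
probability at least `0.9`. -/
def Computes [MeasurableSpace 𝒳] (f : (Fin (n + n) → 𝒳) → ℝ) (β : ℝ) : Prop :=
  (∃ out : P.ViewA → ℝ, Measurable out ∧ ∀ X Y : Fin n → 𝒳,
    0.9 ≤ P.law.real {r | |out (P.viewA X Y r) - f (Fin.append X Y)| ≤ β}) ∨
  (∃ out : P.ViewB → ℝ, Measurable out ∧ ∀ X Y : Fin n → 𝒳,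
    0.9 ≤ P.law.real {r | |out (P.viewB X Y r) - f (Fin.append X Y)| ≤ β})

end Protocol

/-- The sum of blockwise inner products modulo 2, with block length `D`: the first and the second
half of the `2 n` input bits `w = (x, y)` are cut into `⌊n / D⌋` consecutive blocks of length `D`
(the remaining bits are ignored), and the value is the sum over the blocks of the inner product
modulo 2 of the block of `x` and the block of `y`, each being `0` or `1`. -/
noncomputable def blockInnerProduct (n D : ℕ) (w : Fin (n + n) → Bool) : ℝ :=
  ∑ i ∈ Finset.range (n / D),
    (((∑ k ∈ (Finset.univ : Finset (Fin n)).filter (fun k : Fin n => (k : ℕ) / D = i),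
      (w (Fin.castAdd n k) && w (Fin.natAdd n k)).toNat) % 2 : ℕ) : ℝ)

end TwoPartyDP

/-!
Cut the inputs into `m = ⌊n / D⌋` blocks, with `D` of order `log n`. On one pair of blocks `(x, y)`
that is uniformly random, differential privacy makes the view of a party nearly independent of the
inner product of `x` and `y` modulo 2: for a given transcript `x` and `y` are independent, and by
privacy the bits of one of them are not determined by the rest, so that each of the `D` coordinates
shrinks the correlation by a constant factor, up to an error `O(D δ)`. For `m` blocks, a hybrid
argument replaces one after the other the blocks of inner product `0` by blocks of inner product
`1`, which changes the distribution of the view by `m (e ^ (-Ω(D)) + O(D δ)) < 0.1` in total. The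
function, however, changes from `0` to `m`, so its value cannot be estimated within `m / 2`.

For a symmetric function, encode the bit `b` at position `k` as the element `2 k + b` of `[2 n]`;
then both parties have the bit `1` at position `k` iff `2 k + 1` occurs twice.
-/

namespace TwoPartyDP

open ProbabilityTheory

section SemiRandom

variable {D : ℕ}

/-- The cube `{0, 1} ^ D`. -/
abbrev Cube (D : ℕ) : Type := Fin D → Bool

/-- The point of the cube with coordinate `j` flipped. -/
def flipAt (j : Fin D) (x : Cube D) : Cube D := Function.update x j (!x j)

/-- The sign `(-1) ^ ⟨x, y⟩` of the inner product of two points of the cube. -/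
def ipSign (x y : Cube D) : ℝ := ∏ i, if x i && y i then -1 else 1

/-- The unnormalized Fourier transform of a function on the cube. -/
def fourier (b : Cube D → ℝ) (x : Cube D) : ℝ := ∑ y, ipSign x y * b y

/-- The restriction of a function on the cube to the face where coordinate `0` equals `c`. -/
def slice (c : Bool) (a : Cube (D + 1) → ℝ) (z : Cube D) : ℝ := a (Fin.cons c z)

/-- The marginal of `a` on the coordinates after coordinate `0`. -/
def tailMarginal (a : Cube (D + 1) → ℝ) : Cube D → ℝ := slice false a + slice true a

/-- The total amount by which `a` violates the bound `a x ≤ E * a x'` for adjacent `x`, `x'`.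
It vanishes for the densities of `log E`-differentially private data. -/
def ratioDefect (E : ℝ) (a : Cube D → ℝ) : ℝ :=
  ∑ j, ∑ x, max 0 (a x - E * a (flipAt j x))

open Classical in
/-- The `0`-`1` indicator that `u` and `v` are within a factor `G` of each other. -/
noncomputable def balanced (G u v : ℝ) : ℝ := if u ≤ G * v ∧ v ≤ G * u then 1 else 0

/-- The indicator of the points of the cube where each bit, given the later bits, has conditional
odds between `1 / G` and `G` under the weights `a`. -/
noncomputable def suffixBalanced (G : ℝ) : {D : ℕ} → (Cube D → ℝ) → Cube D → ℝ
  | 0, _, _ => 1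
  | _ + 1, a, x =>
    balanced G (slice false a (Fin.tail x)) (slice true a (Fin.tail x)) *
      suffixBalanced G (tailMarginal a) (Fin.tail x)

/-- The indicator of the points of the cube where each bit, given the earlier bits, has conditional
odds between `1 / G` and `G` under the weights `b`. -/
noncomputable def prefixBalanced (G : ℝ) : {D : ℕ} → (Cube D → ℝ) → Cube D → ℝ
  | 0, _, _ => 1
  | _ + 1, b, y =>
    balanced G (∑ z, slice false b z) (∑ z, slice true b z) *
      prefixBalanced G (slice (y 0) b) (Fin.tail y)

/-- The Fourier transform of the restriction of `b` to its prefix-balanced points. -/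
noncomputable def balancedFourier (G : ℝ) (b : Cube D → ℝ) : Cube D → ℝ :=
  fourier (prefixBalanced G b * b)

/-- The factor by which one more pair of `G`-balanced bits shrinks the second moment of the bias of
the inner product. -/
noncomputable def contraction (G : ℝ) : ℝ := 1 - 4 * G / (G + 1) ^ 3

lemma ipSign_cons (c d : Bool) (x y : Cube D) :
    ipSign (Fin.cons c x : Cube (D + 1)) (Fin.cons d y) =
      (if c && d then -1 else 1) * ipSign x y := by
  simp [ipSign, Fin.prod_univ_succ]

lemma ipSign_comm (x y : Cube D) : ipSign x y = ipSign y x := by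
  simp [ipSign, and_comm]

lemma abs_ipSign (x y : Cube D) : |ipSign x y| = 1 := by
  rw [ipSign, Finset.abs_prod]
  refine Finset.prod_eq_one fun i _ => ?_
  split_ifs <;> simp

lemma slice_nonneg {a : Cube (D + 1) → ℝ} (ha : 0 ≤ a) (c : Bool) : 0 ≤ slice c a :=
  fun _ => ha _

lemma sum_cube_succ (a : Cube (D + 1) → ℝ) :
    ∑ x, a x = ∑ z, slice false a z + ∑ z, slice true a z := by
  rw [← (Fin.consEquiv fun _ : Fin (D + 1) => Bool).sum_comp a, Fintype.sum_prod_type]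
  simp [Fin.consEquiv, slice, add_comm]

lemma tailMarginal_nonneg {a : Cube (D + 1) → ℝ} (ha : 0 ≤ a) : 0 ≤ tailMarginal a :=
  add_nonneg (slice_nonneg ha _) (slice_nonneg ha _)

lemma sum_tailMarginal (a : Cube (D + 1) → ℝ) : ∑ z, tailMarginal a z = ∑ x, a x := by
  simp only [sum_cube_succ a, tailMarginal, Pi.add_apply, Finset.sum_add_distrib]

lemma fourier_cons (b : Cube (D + 1) → ℝ) (c : Bool) (x : Cube D) :
    fourier b (Fin.cons c x) =
      fourier (slice false b) x + (if c then -1 else 1) * fourier (slice true b) x := by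
  simp only [fourier, sum_cube_succ, slice, ipSign_cons, Finset.mul_sum]
  cases c <;> simp

lemma fourier_smul (t : ℝ) (b : Cube D → ℝ) : fourier (t • b) = t • fourier b := by
  ext x
  simp [fourier, Finset.mul_sum, mul_left_comm]

lemma fourier_add (b c : Cube D → ℝ) : fourier (b + c) = fourier b + fourier c := by
  ext x
  simp [fourier, mul_add, Finset.sum_add_distrib]

lemma abs_fourier_le {b : Cube D → ℝ} (hb : 0 ≤ b) (x : Cube D) : |fourier b x| ≤ ∑ y, b y := by
  refine (Finset.abs_sum_le_sum_abs _ _).trans_eq (Finset.sum_congr rfl fun y _ => ?_)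
  rw [abs_mul, abs_ipSign, one_mul, abs_of_nonneg (hb y)]

lemma balanced_mem_Icc (G u v : ℝ) : balanced G u v ∈ Set.Icc (0 : ℝ) 1 := by
  unfold balanced
  split_ifs <;> simp

lemma balanced_sq (G u v : ℝ) : balanced G u v ^ 2 = balanced G u v := by
  unfold balanced
  split_ifs <;> simp

lemma suffixBalanced_mem_Icc (G : ℝ) :
    ∀ {D : ℕ} (a : Cube D → ℝ) (x : Cube D), suffixBalanced G a x ∈ Set.Icc (0 : ℝ) 1
  | 0, _, _ => by simp [suffixBalanced]
  | _ + 1, _, _ => unitInterval.mul_mem (balanced_mem_Icc _ _ _) (suffixBalanced_mem_Icc G _ _)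

lemma prefixBalanced_mem_Icc (G : ℝ) :
    ∀ {D : ℕ} (b : Cube D → ℝ) (y : Cube D), prefixBalanced G b y ∈ Set.Icc (0 : ℝ) 1
  | 0, _, _ => by simp [prefixBalanced]
  | _ + 1, _, _ => unitInterval.mul_mem (balanced_mem_Icc _ _ _) (prefixBalanced_mem_Icc G _ _)

lemma suffixBalanced_cons (G : ℝ) (a : Cube (D + 1) → ℝ) (c : Bool) (z : Cube D) :
    suffixBalanced G a (Fin.cons c z) = balanced G (slice false a z) (slice true a z) *
      suffixBalanced G (tailMarginal a) z := by
  simp [suffixBalanced]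

lemma prefixBalanced_cons (G : ℝ) (b : Cube (D + 1) → ℝ) (c : Bool) (z : Cube D) :
    prefixBalanced G b (Fin.cons c z) =
      balanced G (∑ z, slice false b z) (∑ z, slice true b z) *
        prefixBalanced G (slice c b) z := by
  simp [prefixBalanced]

lemma slice_prefixBalanced_mul (G : ℝ) (b : Cube (D + 1) → ℝ) (c : Bool) :
    slice c (prefixBalanced G b * b) = balanced G (∑ z, slice false b z) (∑ z, slice true b z) •
      (prefixBalanced G (slice c b) * slice c b) := by
  ext z
  simp only [slice, Pi.mul_apply, Pi.smul_apply, smul_eq_mul, prefixBalanced_cons, mul_assoc]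

lemma contraction_nonneg {G : ℝ} (hG : 1 ≤ G) : 0 ≤ contraction G := by
  rw [contraction, sub_nonneg, div_le_one (by positivity)]
  nlinarith [sq_nonneg (G - 1), sq_nonneg G]

lemma two_point_le {G u v : ℝ} (hG : 1 ≤ G) (hu : 0 ≤ u) (hv : 0 ≤ v) (p q : ℝ) :
    balanced G u v * (u * (p + q) ^ 2 + v * (p - q) ^ 2) ≤
      (u + v) * (p ^ 2 + q ^ 2 + 2 * ((G - 1) / (G + 1)) * |p * q|) := by
  have hG1 : 0 < G + 1 := by linarith
  have : 0 ≤ (G - 1) / (G + 1) := div_nonneg (by linarith) hG1.le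
  unfold balanced
  split_ifs with h
  · obtain ⟨huv, hvu⟩ := h
    have bias_le : |u - v| ≤ (G - 1) / (G + 1) * (u + v) := by
      rw [div_mul_eq_mul_div, le_div_iff₀ hG1]
      cases abs_cases (u - v) <;> nlinarith
    have bias_mul_le : (u - v) * (p * q) ≤ (G - 1) / (G + 1) * (u + v) * |p * q| :=
      (le_abs_self _).trans (by rw [abs_mul]; gcongr)
    nlinarith
  · rw [zero_mul]
    positivity

lemma balanced_mul_le_contraction_mul {G : ℝ} (hG : 1 ≤ G) (u v : ℝ) :
    balanced G u v * (u ^ 2 + v ^ 2 + 2 * ((G - 1) / (G + 1)) * (u * v)) ≤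
      contraction G * (u + v) ^ 2 := by
  have : 0 < G + 1 := by linarith
  unfold balanced
  split_ifs with h
  · obtain ⟨huv, hvu⟩ := h
    have product_ge : G / (G + 1) ^ 2 * (u + v) ^ 2 ≤ u * v := by
      rw [div_mul_eq_mul_div, div_le_iff₀ (by positivity)]
      nlinarith [mul_nonneg (sub_nonneg.2 huv) (sub_nonneg.2 hvu)]
    calc 1 * (u ^ 2 + v ^ 2 + 2 * ((G - 1) / (G + 1)) * (u * v))
        = (u + v) ^ 2 - 4 / (G + 1) * (u * v) := by field_simp; ring
      _ ≤ (u + v) ^ 2 - 4 / (G + 1) * (G / (G + 1) ^ 2 * (u + v) ^ 2) := by gcongr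
      _ = contraction G * (u + v) ^ 2 := by rw [contraction]; field_simp
  · rw [zero_mul]
    exact mul_nonneg (contraction_nonneg hG) (sq_nonneg _)

lemma sq_sum_mul_abs_mul_le {ι : Type*} (s : Finset ι) {w : ι → ℝ} (hw : 0 ≤ w) (p q : ι → ℝ) :
    (∑ i ∈ s, w i * |p i * q i|) ^ 2 ≤
      (∑ i ∈ s, w i * p i ^ 2) * ∑ i ∈ s, w i * q i ^ 2 :=
  Finset.sum_sq_le_sum_mul_sum_of_sq_le_mul s (fun i _ => mul_nonneg (hw i) (sq_nonneg _))
    (fun i _ => mul_nonneg (hw i) (sq_nonneg _))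
    (fun i _ => le_of_eq (by rw [mul_pow, sq_abs]; ring))

lemma sum_mul_quadratic_le {ι : Type*} (s : Finset ι) {w p q : ι → ℝ} {ρ M u v : ℝ} (hw : 0 ≤ w)
    (hρ : 0 ≤ ρ) (hM : 0 ≤ M) (hu : 0 ≤ u) (hv : 0 ≤ v)
    (hp : ∑ i ∈ s, w i * p i ^ 2 ≤ M * u ^ 2) (hq : ∑ i ∈ s, w i * q i ^ 2 ≤ M * v ^ 2) :
    ∑ i ∈ s, w i * (p i ^ 2 + q i ^ 2 + 2 * ρ * |p i * q i|) ≤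
      M * (u ^ 2 + v ^ 2 + 2 * ρ * (u * v)) := by
  have cross : ∑ i ∈ s, w i * |p i * q i| ≤ M * (u * v) := by
    refine le_of_sq_le_sq ((sq_sum_mul_abs_mul_le s hw p q).trans ?_) (by positivity)
    exact (mul_le_mul hp hq (Finset.sum_nonneg fun i _ => mul_nonneg (hw i) (sq_nonneg _))
      (by positivity)).trans_eq (by ring)
  calc _ = ∑ i ∈ s, w i * p i ^ 2 + ∑ i ∈ s, w i * q i ^ 2 +
        2 * ρ * ∑ i ∈ s, w i * |p i * q i| := by
        simp only [Finset.mul_sum, mul_add, Finset.sum_add_distrib, mul_left_comm (2 * ρ)]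
    _ ≤ M * u ^ 2 + M * v ^ 2 + 2 * ρ * (M * (u * v)) := by gcongr
    _ = M * (u ^ 2 + v ^ 2 + 2 * ρ * (u * v)) := by ring

lemma balancedFourier_cons (G : ℝ) (b : Cube (D + 1) → ℝ) (c : Bool) (z : Cube D) :
    balancedFourier G b (Fin.cons c z) =
      balanced G (∑ z, slice false b z) (∑ z, slice true b z) *
        (balancedFourier G (slice false b) z +
          (if c then -1 else 1) * balancedFourier G (slice true b) z) := by
  simp only [balancedFourier, fourier_cons, slice_prefixBalanced_mul, fourier_smul, Pi.smul_apply,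
    smul_eq_mul]
  ring

lemma sum_balancedFourier_sq_succ_le {G : ℝ} (hG : 1 ≤ G) {a : Cube (D + 1) → ℝ} (ha : 0 ≤ a)
    (b : Cube (D + 1) → ℝ) :
    ∑ x, suffixBalanced G a x * a x * balancedFourier G b x ^ 2 ≤
      balanced G (∑ z, slice false b z) (∑ z, slice true b z) *
        ∑ z, suffixBalanced G (tailMarginal a) z * tailMarginal a z *
          (balancedFourier G (slice false b) z ^ 2 + balancedFourier G (slice true b) z ^ 2 +
            2 * ((G - 1) / (G + 1)) *
              |balancedFourier G (slice false b) z * balancedFourier G (slice true b) z|) := by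
  rw [sum_cube_succ, ← Finset.sum_add_distrib, Finset.mul_sum]
  refine Finset.sum_le_sum fun z _ => ?_
  have two_point := two_point_le hG (ha (Fin.cons false z)) (ha (Fin.cons true z))
    (balancedFourier G (slice false b) z) (balancedFourier G (slice true b) z)
  have weight_nonneg : 0 ≤ balanced G (∑ z, slice false b z) (∑ z, slice true b z) *
      suffixBalanced G (tailMarginal a) z :=
    mul_nonneg (balanced_mem_Icc _ _ _).1 (suffixBalanced_mem_Icc _ _ _).1
  calc _ = _ := by
        simp only [slice, suffixBalanced_cons, balancedFourier_cons, mul_pow, balanced_sq,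
          Bool.false_eq_true, if_false, if_true]
        ring
    _ ≤ _ := mul_le_mul_of_nonneg_left two_point weight_nonneg
    _ = _ := by
        simp only [tailMarginal, slice, Pi.add_apply]
        ring

/- Vazirani's bound on the inner product of two semi-random sources. Conditioning the bits of `a` on
their suffix and those of `b` on their prefix makes both densities shed the same coordinate in each
step of the induction. -/
lemma sum_balancedFourier_sq_le {G : ℝ} (hG : 1 ≤ G) : ∀ {D : ℕ} {a b : Cube D → ℝ},
    0 ≤ a → 0 ≤ b → ∑ x, suffixBalanced G a x * a x * balancedFourier G b x ^ 2 ≤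
      contraction G ^ D * ((∑ x, a x) * (∑ y, b y) ^ 2)
  | 0, a, b, _, _ => by
    simp [suffixBalanced, balancedFourier, prefixBalanced, fourier, ipSign]
  | D + 1, a, b, ha, hb => by
    set p := balancedFourier G (slice false b)
    set q := balancedFourier G (slice true b)
    set w := fun z => suffixBalanced G (tailMarginal a) z * tailMarginal a z
    set A := ∑ z, tailMarginal a z
    set B₀ := ∑ z, slice false b z
    set B₁ := ∑ z, slice true b z
    set c := contraction G
    set ρ := (G - 1) / (G + 1)
    have ha' : 0 ≤ tailMarginal a := tailMarginal_nonneg ha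
    have hM : 0 ≤ c ^ D * A :=
      mul_nonneg (pow_nonneg (contraction_nonneg hG) D) (Finset.sum_nonneg fun z _ => ha' z)
    have hρ : 0 ≤ ρ := div_nonneg (by linarith) (by linarith)
    have quadratic : ∑ z, w z * (p z ^ 2 + q z ^ 2 + 2 * ρ * |p z * q z|) ≤
        c ^ D * A * (B₀ ^ 2 + B₁ ^ 2 + 2 * ρ * (B₀ * B₁)) :=
      sum_mul_quadratic_le _ (fun z => mul_nonneg (suffixBalanced_mem_Icc G _ z).1 (ha' z)) hρ hM
        (Finset.sum_nonneg fun z _ => slice_nonneg hb _ z)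
        (Finset.sum_nonneg fun z _ => slice_nonneg hb _ z)
        ((sum_balancedFourier_sq_le hG ha' (slice_nonneg hb _)).trans_eq (mul_assoc _ _ _).symm)
        ((sum_balancedFourier_sq_le hG ha' (slice_nonneg hb _)).trans_eq (mul_assoc _ _ _).symm)
    calc _ ≤ balanced G B₀ B₁ * ∑ z, w z * (p z ^ 2 + q z ^ 2 + 2 * ρ * |p z * q z|) :=
          sum_balancedFourier_sq_succ_le hG ha b
      _ ≤ balanced G B₀ B₁ * (c ^ D * A * (B₀ ^ 2 + B₁ ^ 2 + 2 * ρ * (B₀ * B₁))) :=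
          mul_le_mul_of_nonneg_left quadratic (balanced_mem_Icc _ _ _).1
      _ = c ^ D * A * (balanced G B₀ B₁ * (B₀ ^ 2 + B₁ ^ 2 + 2 * ρ * (B₀ * B₁))) :=
          mul_left_comm _ _ _
      _ ≤ c ^ D * A * (c * (B₀ + B₁) ^ 2) :=
          mul_le_mul_of_nonneg_left (balanced_mul_le_contraction_mul hG B₀ B₁) hM
      _ = c ^ (D + 1) * ((∑ x, a x) * (∑ y, b y) ^ 2) := by
          rw [sum_cube_succ b, ← sum_tailMarginal a]
          ring

lemma flipAt_cons_zero (c : Bool) (z : Cube D) :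
    flipAt 0 (Fin.cons c z : Cube (D + 1)) = Fin.cons (!c) z := by
  simp [flipAt, Fin.update_cons_zero]

lemma flipAt_cons_succ (c : Bool) (j : Fin D) (z : Cube D) :
    flipAt j.succ (Fin.cons c z : Cube (D + 1)) = Fin.cons c (flipAt j z) := by
  simp [flipAt, Fin.cons_update]

lemma ratioDefect_succ (E : ℝ) (a : Cube (D + 1) → ℝ) :
    ratioDefect E a =
      ∑ z, max 0 (slice false a z - E * slice true a z) +
        ∑ z, max 0 (slice true a z - E * slice false a z) +
      (ratioDefect E (slice false a) + ratioDefect E (slice true a)) := by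
  simp only [ratioDefect, Fin.sum_univ_succ, sum_cube_succ, slice, flipAt_cons_zero,
    flipAt_cons_succ, Finset.sum_add_distrib, Bool.not_false, Bool.not_true]
  exact add_add_add_comm _ _ _ _

lemma ratioDefect_add_le (E : ℝ) (a b : Cube D → ℝ) :
    ratioDefect E (a + b) ≤ ratioDefect E a + ratioDefect E b := by
  simp only [ratioDefect, ← Finset.sum_add_distrib]
  refine Finset.sum_le_sum fun j _ => Finset.sum_le_sum fun x _ => ?_
  refine max_le (add_nonneg (le_max_left _ _) (le_max_left _ _)) ?_
  refine le_of_eq_of_le ?_ (add_le_add (le_max_right 0 _) (le_max_right 0 _))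
  simp only [Pi.add_apply]
  ring

lemma max_zero_sum_sub_le {ι : Type*} (s : Finset ι) (E : ℝ) (u v : ι → ℝ) :
    max 0 (∑ i ∈ s, u i - E * ∑ i ∈ s, v i) ≤ ∑ i ∈ s, max 0 (u i - E * v i) := by
  refine max_le (Finset.sum_nonneg fun _ _ => le_max_left _ _) ?_
  rw [Finset.mul_sum, ← Finset.sum_sub_distrib]
  exact Finset.sum_le_sum fun _ _ => le_max_right _ _

lemma one_sub_balanced_mul_le {E u v : ℝ} (hE : 1 ≤ E) (hu : 0 ≤ u) (hv : 0 ≤ v) :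
    (1 - balanced (2 * E) u v) * (u + v) ≤ 4 * (max 0 (u - E * v) + max 0 (v - E * u)) := by
  have huv := le_max_right 0 (u - E * v)
  have hvu := le_max_right 0 (v - E * u)
  have huv0 := le_max_left 0 (u - E * v)
  have hvu0 := le_max_left 0 (v - E * u)
  unfold balanced
  split_ifs with h
  · rw [sub_self, zero_mul]
    positivity
  · rw [not_and_or, not_le, not_le] at h
    rcases h with h | h <;> nlinarith

lemma one_sub_mul_le_add {s t : ℝ} (hs : s ∈ Set.Icc (0 : ℝ) 1) (ht : t ∈ Set.Icc (0 : ℝ) 1) :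
    1 - s * t ≤ (1 - s) + (1 - t) := by
  nlinarith [mul_nonneg (sub_nonneg.2 hs.2) (sub_nonneg.2 ht.2)]

lemma sum_one_sub_suffixBalanced_le {E : ℝ} (hE : 1 ≤ E) : ∀ {D : ℕ} {a : Cube D → ℝ},
    0 ≤ a → ∑ x, (1 - suffixBalanced (2 * E) a x) * a x ≤ 4 * ratioDefect E a
  | 0, a, _ => by simp [suffixBalanced, ratioDefect]
  | D + 1, a, ha => by
    have tail_le := sum_one_sub_suffixBalanced_le hE (tailMarginal_nonneg ha)
    have defect_le := ratioDefect_add_le E (slice false a) (slice true a)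
    have split_le (z : Cube D) :
        (1 - balanced (2 * E) (slice false a z) (slice true a z) *
          suffixBalanced (2 * E) (tailMarginal a) z) * tailMarginal a z ≤
        4 * (max 0 (slice false a z - E * slice true a z) +
          max 0 (slice true a z - E * slice false a z)) +
        (1 - suffixBalanced (2 * E) (tailMarginal a) z) * tailMarginal a z := by
      refine (mul_le_mul_of_nonneg_right (one_sub_mul_le_add (balanced_mem_Icc _ _ _)
        (suffixBalanced_mem_Icc _ _ _)) (tailMarginal_nonneg ha z)).trans ?_
      rw [add_mul]
      exact add_le_add
        (one_sub_balanced_mul_le hE (slice_nonneg ha _ z) (slice_nonneg ha _ z)) le_rfl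
    calc _ = ∑ z, (1 - balanced (2 * E) (slice false a z) (slice true a z) *
          suffixBalanced (2 * E) (tailMarginal a) z) * tailMarginal a z := by
          rw [sum_cube_succ, ← Finset.sum_add_distrib]
          simp only [slice, suffixBalanced_cons, tailMarginal, Pi.add_apply, mul_add]
      _ ≤ _ := Finset.sum_le_sum fun z _ => split_le z
      _ ≤ 4 * ratioDefect E a := by
          rw [ratioDefect_succ, Finset.sum_add_distrib, ← Finset.mul_sum, Finset.sum_add_distrib]
          rw [tailMarginal] at tail_le ⊢
          linarith

lemma sum_one_sub_prefixBalanced_le {E : ℝ} (hE : 1 ≤ E) : ∀ {D : ℕ} {b : Cube D → ℝ},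
    0 ≤ b → ∑ y, (1 - prefixBalanced (2 * E) b y) * b y ≤ 4 * ratioDefect E b
  | 0, b, _ => by simp [prefixBalanced, ratioDefect]
  | D + 1, b, hb => by
    set t := balanced (2 * E) (∑ z, slice false b z) (∑ z, slice true b z) with ht
    have tail_le (c : Bool) := sum_one_sub_prefixBalanced_le hE (slice_nonneg hb c)
    have head_le : (1 - t) * (∑ z, slice false b z + ∑ z, slice true b z) ≤ _ :=
      one_sub_balanced_mul_le hE (Finset.sum_nonneg fun z _ => slice_nonneg hb _ z)
        (Finset.sum_nonneg fun z _ => slice_nonneg hb _ z)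
    have split_le (c : Bool) :
        ∑ z, slice c (fun y => (1 - prefixBalanced (2 * E) b y) * b y) z ≤
          (1 - t) * ∑ z, slice c b z +
            ∑ z, (1 - prefixBalanced (2 * E) (slice c b) z) * slice c b z := by
      rw [Finset.mul_sum, ← Finset.sum_add_distrib]
      refine Finset.sum_le_sum fun z _ => ?_
      rw [slice, prefixBalanced_cons, ← ht, ← add_mul]
      exact mul_le_mul_of_nonneg_right (one_sub_mul_le_add (balanced_mem_Icc _ _ _)
        (prefixBalanced_mem_Icc _ _ _)) (hb _)
    have false_true := max_zero_sum_sub_le Finset.univ E (slice false b) (slice true b)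
    have true_false := max_zero_sum_sub_le Finset.univ E (slice true b) (slice false b)
    rw [ratioDefect_succ, sum_cube_succ]
    linarith [tail_le false, tail_le true, split_le false, split_le true]

lemma sum_mul_abs_balancedFourier_le {G : ℝ} (hG : 1 ≤ G) {a b : Cube D → ℝ} (ha : 0 ≤ a)
    (hb : 0 ≤ b) :
    ∑ x, suffixBalanced G a x * a x * |balancedFourier G b x| ≤
      √(contraction G) ^ D * ((∑ x, a x) * ∑ y, b y) := by
  have hu (x) := suffixBalanced_mem_Icc G a x
  have hA : 0 ≤ ∑ x, a x := Finset.sum_nonneg fun x _ => ha x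
  have hB : 0 ≤ ∑ y, b y := Finset.sum_nonneg fun y _ => hb y
  have hw : 0 ≤ fun x => suffixBalanced G a x * a x := fun x => mul_nonneg (hu x).1 (ha x)
  have mass_le : ∑ x, suffixBalanced G a x * a x ≤ ∑ x, a x :=
    Finset.sum_le_sum fun x _ => mul_le_of_le_one_left (ha x) (hu x).2
  have cauchy_schwarz := sq_sum_mul_abs_mul_le Finset.univ hw (balancedFourier G b) 1
  simp only [Pi.one_apply, mul_one, one_pow] at cauchy_schwarz
  refine le_of_sq_le_sq (cauchy_schwarz.trans ?_) (by positivity)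
  calc _ ≤ contraction G ^ D * ((∑ x, a x) * (∑ y, b y) ^ 2) * ∑ x, a x :=
        mul_le_mul (sum_balancedFourier_sq_le hG ha hb) mass_le
          (Finset.sum_nonneg fun x _ => hw x)
          (mul_nonneg (pow_nonneg (contraction_nonneg hG) D) (by positivity))
    _ = (√(contraction G) ^ D * ((∑ x, a x) * ∑ y, b y)) ^ 2 := by
        rw [mul_pow, ← pow_mul, mul_comm D 2, pow_mul, Real.sq_sqrt (contraction_nonneg hG)]
        ring

lemma abs_balancedFourier_le (G : ℝ) {b : Cube D → ℝ} (hb : 0 ≤ b) (x : Cube D) :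
    |balancedFourier G b x| ≤ ∑ y, b y := by
  have hv (y) := prefixBalanced_mem_Icc G b y
  exact (abs_fourier_le (fun y => mul_nonneg (hv y).1 (hb y)) x).trans <|
    Finset.sum_le_sum fun y _ => mul_le_of_le_one_left (hb y) (hv y).2

lemma abs_fourier_le_abs_balancedFourier_add {E : ℝ} (hE : 1 ≤ E) {b : Cube D → ℝ} (hb : 0 ≤ b)
    (x : Cube D) :
    |fourier b x| ≤ |balancedFourier (2 * E) b x| + 4 * ratioDefect E b := by
  have rest_nonneg : 0 ≤ (1 - prefixBalanced (2 * E) b) * b :=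
    fun y => mul_nonneg (sub_nonneg.2 (prefixBalanced_mem_Icc _ b y).2) (hb y)
  have decomposition : fourier b x =
      balancedFourier (2 * E) b x + fourier ((1 - prefixBalanced (2 * E) b) * b) x := by
    rw [balancedFourier, ← Pi.add_apply, ← fourier_add, sub_mul, one_mul, add_sub_cancel]
  rw [decomposition]
  exact (abs_add_le _ _).trans <| add_le_add le_rfl <|
    (abs_fourier_le rest_nonneg x).trans (sum_one_sub_prefixBalanced_le hE hb)

lemma sum_mul_abs_fourier_le {E : ℝ} (hE : 1 ≤ E) {a b : Cube D → ℝ} (ha : 0 ≤ a) (hb : 0 ≤ b) :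
    ∑ x, a x * |fourier b x| ≤ √(contraction (2 * E)) ^ D * ((∑ x, a x) * ∑ y, b y) +
      4 * ((∑ y, b y) * ratioDefect E a + (∑ x, a x) * ratioDefect E b) := by
  set u := suffixBalanced (2 * E) a
  have hB : 0 ≤ ∑ y, b y := Finset.sum_nonneg fun y _ => hb y
  calc ∑ x, a x * |fourier b x|
      ≤ ∑ x, (u x * a x * |balancedFourier (2 * E) b x| + (1 - u x) * a x * (∑ y, b y) +
          a x * (4 * ratioDefect E b)) := by
        refine Finset.sum_le_sum fun x _ => ?_
        have unbalanced_weight : 0 ≤ (1 - u x) * a x :=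
          mul_nonneg (sub_nonneg.2 (suffixBalanced_mem_Icc _ a x).2) (ha x)
        linarith [mul_le_mul_of_nonneg_left (abs_fourier_le_abs_balancedFourier_add hE hb x) (ha x),
          mul_le_mul_of_nonneg_left (abs_balancedFourier_le (2 * E) hb x) unbalanced_weight]
    _ = ∑ x, u x * a x * |balancedFourier (2 * E) b x| +
          (∑ x, (1 - u x) * a x) * (∑ y, b y) + (∑ x, a x) * (4 * ratioDefect E b) := by
        simp only [Finset.sum_add_distrib, Finset.sum_mul]
    _ ≤ √(contraction (2 * E)) ^ D * ((∑ x, a x) * ∑ y, b y) +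
          4 * ratioDefect E a * (∑ y, b y) + (∑ x, a x) * (4 * ratioDefect E b) := by
        gcongr
        · exact sum_mul_abs_balancedFourier_le (by linarith) ha hb
        · exact sum_one_sub_suffixBalanced_le hE ha
    _ = _ := by ring

end SemiRandom

section CondIndep

variable {Ω : Type*} {m mA mB mF : MeasurableSpace Ω} {mΩ : MeasurableSpace Ω} {μ : Measure Ω}

lemma sup_eq_generateFrom_inter (mA mB : MeasurableSpace Ω) :
    mA ⊔ mB = MeasurableSpace.generateFrom
      (Set.image2 (· ∩ ·) {s | MeasurableSet[mA] s} {s | MeasurableSet[mB] s}) := by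
  refine le_antisymm (sup_le ?_ ?_) (MeasurableSpace.generateFrom_le ?_)
  · exact fun s hs => MeasurableSpace.measurableSet_generateFrom
      ⟨s, hs, Set.univ, MeasurableSet.univ, Set.inter_univ s⟩
  · exact fun s hs => MeasurableSpace.measurableSet_generateFrom
      ⟨Set.univ, MeasurableSet.univ, s, hs, Set.univ_inter s⟩
  · rintro _ ⟨s, hs, t, ht, rfl⟩
    exact MeasurableSet.inter (le_sup_left (a := mA) s hs) (le_sup_right (b := mB) t ht)

lemma isPiSystem_image2_inter (mA mB : MeasurableSpace Ω) :
    IsPiSystem (Set.image2 (· ∩ ·) {s | MeasurableSet[mA] s} {s | MeasurableSet[mB] s}) := by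
  rintro _ ⟨s, hs, t, ht, rfl⟩ _ ⟨s', hs', t', ht', rfl⟩ _
  exact ⟨s ∩ s', @MeasurableSet.inter _ mA _ _ hs hs', t ∩ t',
    @MeasurableSet.inter _ mB _ _ ht ht', Set.inter_inter_inter_comm _ _ _ _⟩

lemma ae_eq_condExp_sup_of_forall_setIntegral_inter_eq [IsFiniteMeasure μ] (hA : mA ≤ mΩ)
    (hB : mB ≤ mΩ) {f g : Ω → ℝ} (hf : Integrable f μ) (hg : Integrable g μ)
    (hgm : StronglyMeasurable[mA ⊔ mB] g)
    (hfg : ∀ s t, MeasurableSet[mA] s → MeasurableSet[mB] t →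
      ∫ ω in s ∩ t, g ω ∂μ = ∫ ω in s ∩ t, f ω ∂μ) :
    g =ᵐ[μ] μ[f | mA ⊔ mB] := by
  have hS : mA ⊔ mB ≤ mΩ := sup_le hA hB
  have integral_eq : ∫ ω, g ω ∂μ = ∫ ω, f ω ∂μ := by
    simpa using hfg Set.univ Set.univ MeasurableSet.univ MeasurableSet.univ
  refine ae_eq_condExp_of_forall_setIntegral_eq hS hf (fun _ _ _ => hg.integrableOn)
    (fun s hs _ => ?_) hgm.aestronglyMeasurable
  refine MeasurableSpace.induction_on_inter
    (C := fun s _ => ∫ ω in s, g ω ∂μ = ∫ ω in s, f ω ∂μ)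
    (sup_eq_generateFrom_inter mA mB) (isPiSystem_image2_inter mA mB) ?_ ?_ ?_ ?_ s hs
  · simp
  · rintro _ ⟨s, hs, t, ht, rfl⟩
    exact hfg s t hs ht
  · intro t ht ih
    linarith [integral_add_compl (hS t ht) hf, integral_add_compl (hS t ht) hg]
  · intro s hd hs ih
    rw [integral_iUnion (fun i => hS _ (hs i)) hd hg.integrableOn,
      integral_iUnion (fun i => hS _ (hs i)) hd hf.integrableOn]
    exact tsum_congr ih

variable [IsProbabilityMeasure μ]

lemma integrable_indicator_one {s : Set Ω} (hs : MeasurableSet s) :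
    Integrable (s.indicator fun _ => (1 : ℝ)) μ :=
  (integrable_const 1).indicator hs

lemma condExp_indicator_one_mem_Icc (hm : m ≤ mΩ) {s : Set Ω} (hs : MeasurableSet s) :
    ∀ᵐ ω ∂μ, (μ⟦s | m⟧) ω ∈ Set.Icc (0 : ℝ) 1 := by
  have nonneg : 0 ≤ᵐ[μ] μ⟦s | m⟧ :=
    condExp_nonneg (ae_of_all _ fun _ => Set.indicator_nonneg (fun _ _ => zero_le_one) _)
  have le_const := condExp_mono (m := m) (integrable_indicator_one (μ := μ) hs)
    (integrable_const (1 : ℝ))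
    (ae_of_all _ fun _ => Set.indicator_le_self' (fun _ _ => zero_le_one) _)
  rw [condExp_const hm] at le_const
  filter_upwards [nonneg, le_const] with ω h0 h1 using ⟨h0, h1⟩

lemma setIntegral_condExp_indicator_one (hm : m ≤ mΩ) {s t : Set Ω} (hs : MeasurableSet s)
    (ht : MeasurableSet[m] t) : ∫ ω in t, (μ⟦s | m⟧) ω ∂μ = μ.real (s ∩ t) := by
  rw [setIntegral_condExp hm (integrable_indicator_one hs) ht, setIntegral_indicator hs,
    setIntegral_one_eq_measureReal, Set.inter_comm]

lemma setIntegral_eq_integral_mul_condExp (hm : m ≤ mΩ) {s : Set Ω} (hs : MeasurableSet s)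
    {g : Ω → ℝ} (hgm : StronglyMeasurable[m] g) (hg : Integrable g μ) :
    ∫ ω in s, g ω ∂μ = ∫ ω, g ω * (μ⟦s | m⟧) ω ∂μ := by
  have indicator_eq : s.indicator g = g * s.indicator fun _ => (1 : ℝ) := by
    ext ω
    by_cases hω : ω ∈ s <;> simp [hω]
  have pull_out := condExp_mul_of_stronglyMeasurable_left hgm (indicator_eq ▸ hg.indicator hs)
    (integrable_indicator_one (μ := μ) hs)
  rw [← integral_indicator hs, indicator_eq, ← integral_condExp hm]
  exact integral_congr_ae pull_out

variable [StandardBorelSpace Ω]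

lemma setIntegral_condExp_mul_condExp {hF : mF ≤ mΩ} (hA : mA ≤ mΩ) (hB : mB ≤ mΩ)
    (h : CondIndep mF mA mB hF μ) {s t u : Set Ω} (hs : MeasurableSet[mA] s)
    (ht : MeasurableSet[mB] t) (hu : MeasurableSet[mF] u) :
    ∫ ω in u, (μ⟦s | mF⟧) ω * (μ⟦t | mF⟧) ω ∂μ = μ.real (s ∩ t ∩ u) := by
  rw [← setIntegral_condExp_indicator_one hF ((hA s hs).inter (hB t ht)) hu]
  have product_ae_eq := (condIndep_iff mF mA mB hF hA hB μ).1 h s t hs ht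
  exact setIntegral_congr_ae (hF u hu) (product_ae_eq.mono fun ω hω _ => hω.symm)

lemma condExp_sup_ae_eq_of_condIndep {hF : mF ≤ mΩ} (hA : mA ≤ mΩ) (hB : mB ≤ mΩ)
    (h : CondIndep mF mA mB hF μ) {t : Set Ω} (ht : MeasurableSet[mB] t) :
    μ⟦t | mA ⊔ mF⟧ =ᵐ[μ] μ⟦t | mF⟧ := by
  have measurable_sup : StronglyMeasurable[mA ⊔ mF] (μ⟦t | mF⟧) :=
    stronglyMeasurable_condExp.mono le_sup_right
  refine (ae_eq_condExp_sup_of_forall_setIntegral_inter_eq hA hF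
    (integrable_indicator_one (hB t ht)) integrable_condExp measurable_sup
    fun s u hs hu => ?_).symm
  calc ∫ ω in s ∩ u, (μ⟦t | mF⟧) ω ∂μ
      = ∫ ω in s, u.indicator (μ⟦t | mF⟧) ω ∂μ := (setIntegral_indicator (hF u hu)).symm
    _ = ∫ ω, u.indicator (μ⟦t | mF⟧) ω * (μ⟦s | mF⟧) ω ∂μ :=
        setIntegral_eq_integral_mul_condExp hF (hA s hs)
          (stronglyMeasurable_condExp.indicator hu) (integrable_condExp.indicator (hF u hu))
    _ = ∫ ω in u, (μ⟦s | mF⟧) ω * (μ⟦t | mF⟧) ω ∂μ := by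
        rw [← integral_indicator (hF u hu)]
        congr with ω
        by_cases hω : ω ∈ u <;> simp [hω, mul_comm]
    _ = μ.real (s ∩ t ∩ u) := setIntegral_condExp_mul_condExp hA hB h hs ht hu
    _ = ∫ ω in s ∩ u, t.indicator (fun _ => (1 : ℝ)) ω ∂μ := by
        rw [setIntegral_indicator (hB t ht), setIntegral_one_eq_measureReal, Set.inter_right_comm]

lemma condIndep_of_condExp_sup_ae_eq (hF : mF ≤ mΩ) (hA : mA ≤ mΩ) (hB : mB ≤ mΩ)
    (h : ∀ t, MeasurableSet[mB] t → μ⟦t | mA ⊔ mF⟧ =ᵐ[μ] μ⟦t | mF⟧) :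
    CondIndep mF mA mB hF μ := by
  refine (condIndep_iff mF mA mB hF hA hB μ).2 fun s t hs ht => ?_
  have indicator_mul (g : Ω → ℝ) : s.indicator g = s.indicator (fun _ => (1 : ℝ)) * g := by
    ext ω
    by_cases hω : ω ∈ s <;> simp [hω]
  have given_sup : μ⟦s ∩ t | mA ⊔ mF⟧ =ᵐ[μ] s.indicator (μ⟦t | mF⟧) := by
    rw [← Set.indicator_indicator]
    exact (condExp_indicator (integrable_indicator_one (hB t ht))
      ((le_sup_left : mA ≤ mA ⊔ mF) s hs)).trans (h t ht).indicator
  calc μ⟦s ∩ t | mF⟧ =ᵐ[μ] μ[μ⟦s ∩ t | mA ⊔ mF⟧ | mF] :=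
        (condExp_condExp_of_le le_sup_right (sup_le hA hF)).symm
    _ =ᵐ[μ] μ[s.indicator (fun _ => (1 : ℝ)) * μ⟦t | mF⟧ | mF] :=
        condExp_congr_ae (indicator_mul (μ⟦t | mF⟧) ▸ given_sup)
    _ =ᵐ[μ] μ⟦s | mF⟧ * μ⟦t | mF⟧ :=
        condExp_mul_of_stronglyMeasurable_right stronglyMeasurable_condExp
          (indicator_mul (μ⟦t | mF⟧) ▸ integrable_condExp.indicator (hA s hs))
          (integrable_indicator_one (hA s hs))

lemma condIndep_bot_of_indep (hA : mA ≤ mΩ) (hB : mB ≤ mΩ) (h : Indep mB mA μ) :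
    CondIndep ⊥ mA mB bot_le μ := by
  refine condIndep_of_condExp_sup_ae_eq bot_le hA hB fun t ht => ?_
  rw [sup_bot_eq, condExp_bot]
  exact condExp_indep_eq hB hA (stronglyMeasurable_const.indicator ht) h

lemma condIndep_sup_of_le_sup_left {hF : mF ≤ mΩ} (hA : mA ≤ mΩ) (hB : mB ≤ mΩ)
    (h : CondIndep mF mA mB hF μ) (hm : m ≤ mA ⊔ mF) :
    CondIndep (mF ⊔ m) mA mB (sup_le hF (hm.trans (sup_le hA hF))) μ := by
  have hle : mF ⊔ m ≤ mA ⊔ mF := sup_le le_sup_right hm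
  have hS : mA ⊔ mF ≤ mΩ := sup_le hA hF
  have sup_eq : mA ⊔ (mF ⊔ m) = mA ⊔ mF :=
    le_antisymm (sup_le le_sup_left hle) (sup_le_sup_left le_sup_left _)
  refine condIndep_of_condExp_sup_ae_eq _ hA hB fun t ht => ?_
  have given_sup := condExp_sup_ae_eq_of_condIndep hA hB h ht
  rw [sup_eq]
  calc μ⟦t | mA ⊔ mF⟧ =ᵐ[μ] μ⟦t | mF⟧ := given_sup
    _ = μ[μ⟦t | mF⟧ | mF ⊔ m] := (condExp_of_stronglyMeasurable (hle.trans hS)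
        (stronglyMeasurable_condExp.mono le_sup_left) integrable_condExp).symm
    _ =ᵐ[μ] μ[μ⟦t | mA ⊔ mF⟧ | mF ⊔ m] := condExp_congr_ae given_sup.symm
    _ =ᵐ[μ] μ⟦t | mF ⊔ m⟧ := condExp_condExp_of_le hle hS

lemma condIndep_sup_of_le_sup_right {hF : mF ≤ mΩ} (hA : mA ≤ mΩ) (hB : mB ≤ mΩ)
    (h : CondIndep mF mA mB hF μ) (hm : m ≤ mB ⊔ mF) :
    CondIndep (mF ⊔ m) mA mB (sup_le hF (hm.trans (sup_le hB hF))) μ :=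
  (condIndep_sup_of_le_sup_left hB hA h.symm hm).symm

end CondIndep

section InnerProductBias

variable {Ω : Type*} {m mA mB mF : MeasurableSpace Ω} {mΩ : MeasurableSpace Ω} {μ : Measure Ω}
  {D : ℕ} {E δ : ℝ}

/-- The conditional law given `m` of a random point `Z` of the cube, as a vector of conditional
probabilities. -/
noncomputable def condLaw (μ : Measure Ω) (m : MeasurableSpace Ω) (Z : Ω → Cube D) (ω : Ω) :
    Cube D → ℝ :=
  fun z => (μ⟦Z ⁻¹' {z} | m⟧) ω

lemma sum_mul_ratioDefect (E : ℝ) (a : Cube D → ℝ) {b : Cube D → ℝ} (hb : 0 ≤ b) :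
    (∑ y, b y) * ratioDefect E a =
      ∑ y, ∑ j, ∑ x, max 0 (a x * b y - E * (a (flipAt j x) * b y)) := by
  simp only [ratioDefect, Finset.sum_mul]
  refine Finset.sum_congr rfl fun y _ => ?_
  simp only [Finset.mul_sum]
  refine Finset.sum_congr rfl fun j _ => Finset.sum_congr rfl fun x _ => ?_
  rw [mul_max_of_nonneg _ _ (hb y), mul_zero]
  ring_nf

lemma integral_max_zero_sub_le (hm : m ≤ mΩ) {p q : Ω → ℝ} (hpm : StronglyMeasurable[m] p)
    (hqm : StronglyMeasurable[m] q) (hp : Integrable p μ) (hq : Integrable q μ)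
    (h : ∀ u, MeasurableSet[m] u → ∫ ω in u, p ω ∂μ ≤ E * ∫ ω in u, q ω ∂μ + δ) :
    ∫ ω, max 0 (p ω - E * q ω) ∂μ ≤ δ := by
  have hu : MeasurableSet[m] {ω | E * q ω < p ω} :=
    measurableSet_lt (hqm.measurable.const_mul E) hpm.measurable
  have max_eq_indicator : (fun ω => max 0 (p ω - E * q ω)) =
      {ω | E * q ω < p ω}.indicator fun ω => p ω - E * q ω := by
    ext ω
    by_cases hω : E * q ω < p ω
    · simp [hω, hω.le]
    · simp [hω, not_lt.1 hω]
  rw [max_eq_indicator, integral_indicator (hm _ hu),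
    integral_sub hp.integrableOn (hq.const_mul E).integrableOn, integral_const_mul]
  linarith [h _ hu]

lemma stronglyMeasurable_condLaw (Z : Ω → Cube D) (z : Cube D) :
    StronglyMeasurable[m] fun ω => condLaw μ m Z ω z :=
  stronglyMeasurable_condExp

lemma integrable_condLaw (Z : Ω → Cube D) (z : Cube D) :
    Integrable (fun ω => condLaw μ m Z ω z) μ :=
  integrable_condExp

lemma integrable_ratioDefect_condLaw (E : ℝ) (Z : Ω → Cube D) :
    Integrable (fun ω => ratioDefect E (condLaw μ m Z ω)) μ :=
  integrable_finsetSum _ fun _ _ => integrable_finsetSum _ fun _ _ =>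
    (integrable_zero _ _ _).sup
      ((integrable_condLaw Z _).sub ((integrable_condLaw Z _).const_mul E))

lemma stronglyMeasurable_abs_fourier_condLaw (Z : Ω → Cube D) (x : Cube D) :
    StronglyMeasurable[m] fun ω => |fourier (condLaw μ m Z ω) x| :=
  StronglyMeasurable.norm (Finset.stronglyMeasurable_fun_sum _ fun y _ =>
    (stronglyMeasurable_condLaw Z y).const_mul (ipSign x y))

lemma integrable_fourier_condLaw (Z : Ω → Cube D) (x : Cube D) :
    Integrable (fun ω => fourier (condLaw μ m Z ω) x) μ :=
  integrable_finsetSum _ fun y _ => (integrable_condLaw Z y).const_mul (ipSign x y)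

lemma condLaw_nonneg (Z : Ω → Cube D) : ∀ᵐ ω ∂μ, 0 ≤ condLaw μ m Z ω :=
  ae_all_iff.2 fun _ =>
    condExp_nonneg (ae_of_all _ fun _ => Set.indicator_nonneg (fun _ _ => zero_le_one) _)

variable [IsProbabilityMeasure μ]

lemma sum_condLaw (hm : m ≤ mΩ) {Z : Ω → Cube D} (hZ : Measurable Z) :
    ∀ᵐ ω ∂μ, ∑ z, condLaw μ m Z ω z = 1 := by
  have sum_indicator :
      ∑ z, (Z ⁻¹' {z}).indicator (fun _ => (1 : ℝ)) = fun _ => (1 : ℝ) := by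
    ext ω
    rw [Finset.sum_apply, Finset.sum_eq_single (Z ω) (fun z _ hz => ?_) (by simp)]
    · simp
    · exact Set.indicator_of_notMem (fun h => hz h.symm) _
  have condExp_sum := condExp_finsetSum (μ := μ) (s := Finset.univ) (fun z _ =>
    integrable_indicator_one (hZ (measurableSet_singleton z))) m
  rw [sum_indicator, condExp_const hm] at condExp_sum
  filter_upwards [condExp_sum] with ω hω
  rw [Finset.sum_apply] at hω
  exact hω.symm

lemma integrable_condLaw_mul (hm : m ≤ mΩ) {Z : Ω → Cube D} (hZ : Measurable Z)
    (z : Cube D) {g : Ω → ℝ} (hg : Integrable g μ) :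
    Integrable (fun ω => condLaw μ m Z ω z * g ω) μ := by
  refine hg.bdd_mul ((stronglyMeasurable_condLaw Z z).mono hm).aestronglyMeasurable (c := 1) ?_
  filter_upwards [condExp_indicator_one_mem_Icc hm (hZ (measurableSet_singleton z))] with ω hω
  exact (Real.norm_of_nonneg hω.1).trans_le hω.2

lemma integral_ratioDefect_condLaw_le (hm : m ≤ mΩ) {X Y : Ω → Cube D} (hX : Measurable X)
    (hY : Measurable Y)
    (h : ∀ x y j u, MeasurableSet[m] u → ∫ ω in u, condLaw μ m X ω x * condLaw μ m Y ω y ∂μ ≤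
      E * ∫ ω in u, condLaw μ m X ω (flipAt j x) * condLaw μ m Y ω y ∂μ + δ) :
    ∫ ω, ratioDefect E (condLaw μ m X ω) ∂μ ≤ D * 4 ^ D * δ := by
  have product_integrable (x y : Cube D) :
      Integrable (fun ω => condLaw μ m X ω x * condLaw μ m Y ω y) μ :=
    integrable_condLaw_mul hm hX x (integrable_condLaw Y y)
  have term_integrable (y : Cube D) (j : Fin D) (x : Cube D) : Integrable (fun ω => max 0
      (condLaw μ m X ω x * condLaw μ m Y ω y -
        E * (condLaw μ m X ω (flipAt j x) * condLaw μ m Y ω y))) μ :=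
    (integrable_zero _ _ _).sup
      ((product_integrable x y).sub ((product_integrable _ y).const_mul E))
  have expand : (fun ω => ratioDefect E (condLaw μ m X ω)) =ᵐ[μ] fun ω => ∑ y, ∑ j, ∑ x, max 0
      (condLaw μ m X ω x * condLaw μ m Y ω y -
        E * (condLaw μ m X ω (flipAt j x) * condLaw μ m Y ω y)) := by
    filter_upwards [condLaw_nonneg Y, sum_condLaw hm hY] with ω nonneg sum_eq_one
    rw [← sum_mul_ratioDefect E _ nonneg, sum_eq_one, one_mul]
  have term_le (y : Cube D) (j : Fin D) (x : Cube D) : ∫ ω, max 0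
      (condLaw μ m X ω x * condLaw μ m Y ω y -
        E * (condLaw μ m X ω (flipAt j x) * condLaw μ m Y ω y)) ∂μ ≤ δ :=
    integral_max_zero_sub_le hm
      ((stronglyMeasurable_condLaw X x).mul (stronglyMeasurable_condLaw Y y))
      ((stronglyMeasurable_condLaw X _).mul (stronglyMeasurable_condLaw Y y))
      (product_integrable x y) (product_integrable _ y) (h x y j)
  rw [integral_congr_ae expand, integral_finsetSum _ fun y _ => integrable_finsetSum _ fun j _ =>
      integrable_finsetSum _ fun x _ => term_integrable y j x]
  calc _ ≤ ∑ _y : Cube D, ∑ _j : Fin D, ∑ _x : Cube D, δ := by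
        refine Finset.sum_le_sum fun y _ => ?_
        rw [integral_finsetSum _ fun j _ => integrable_finsetSum _ fun x _ => term_integrable y j x]
        refine Finset.sum_le_sum fun j _ => ?_
        rw [integral_finsetSum _ fun x _ => term_integrable y j x]
        exact Finset.sum_le_sum fun x _ => term_le y j x
    _ = D * 4 ^ D * δ := by
        simp only [Finset.sum_const, Finset.card_univ, Fintype.card_fun, Fintype.card_bool,
          Fintype.card_fin, nsmul_eq_mul, Nat.cast_pow, Nat.cast_ofNat]
        rw [show (4 : ℝ) = 2 * 2 by norm_num, mul_pow]
        ring

lemma integral_sum_condLaw_mul_abs_fourier_le (hm : m ≤ mΩ) (hE : 1 ≤ E) {X Y : Ω → Cube D}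
    (hX : Measurable X) (hY : Measurable Y) :
    ∫ ω, ∑ x, condLaw μ m X ω x * |fourier (condLaw μ m Y ω) x| ∂μ ≤
      √(contraction (2 * E)) ^ D + 4 * (∫ ω, ratioDefect E (condLaw μ m X ω) ∂μ +
        ∫ ω, ratioDefect E (condLaw μ m Y ω) ∂μ) := by
  have defects_integrable : Integrable (fun ω =>
      4 * (ratioDefect E (condLaw μ m X ω) + ratioDefect E (condLaw μ m Y ω))) μ :=
    ((integrable_ratioDefect_condLaw E X).add (integrable_ratioDefect_condLaw E Y)).const_mul 4
  calc ∫ ω, ∑ x, condLaw μ m X ω x * |fourier (condLaw μ m Y ω) x| ∂μ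
      ≤ ∫ ω, (√(contraction (2 * E)) ^ D +
          4 * (ratioDefect E (condLaw μ m X ω) + ratioDefect E (condLaw μ m Y ω))) ∂μ := by
        refine integral_mono_ae (integrable_finsetSum _ fun x _ =>
          integrable_condLaw_mul hm hX x (integrable_fourier_condLaw Y x).abs)
          ((integrable_const _).add defects_integrable) ?_
        filter_upwards [condLaw_nonneg (m := m) X, condLaw_nonneg (m := m) Y, sum_condLaw hm hX,
          sum_condLaw hm hY] with ω X_nonneg Y_nonneg X_sum Y_sum
        simpa only [X_sum, Y_sum, one_mul, mul_one] using
          sum_mul_abs_fourier_le hE X_nonneg Y_nonneg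
    _ = √(contraction (2 * E)) ^ D + 4 * (∫ ω, ratioDefect E (condLaw μ m X ω) ∂μ +
          ∫ ω, ratioDefect E (condLaw μ m Y ω) ∂μ) := by
        rw [integral_add (integrable_const _) defects_integrable, integral_const_mul,
          integral_add (integrable_ratioDefect_condLaw E X) (integrable_ratioDefect_condLaw E Y),
          integral_const, probReal_univ, one_smul]

variable [StandardBorelSpace Ω]

lemma setIntegral_condLaw_mul_condLaw {hF : mF ≤ mΩ} (hA : mA ≤ mΩ) (hB : mB ≤ mΩ)
    (h : CondIndep mF mA mB hF μ) {X Y : Ω → Cube D} (hX : Measurable[mA] X)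
    (hY : Measurable[mB] Y) (x y : Cube D) {u : Set Ω} (hu : MeasurableSet[mF] u) :
    ∫ ω in u, condLaw μ mF X ω x * condLaw μ mF Y ω y ∂μ =
      μ.real (X ⁻¹' {x} ∩ Y ⁻¹' {y} ∩ u) :=
  setIntegral_condExp_mul_condExp hA hB h (hX (measurableSet_singleton x))
    (hY (measurableSet_singleton y)) hu

lemma abs_sum_ipSign_mul_measureReal_le {hF : mF ≤ mΩ} (hA : mA ≤ mΩ) (hB : mB ≤ mΩ)
    (h : CondIndep mF mA mB hF μ) {Y : Ω → Cube D} (hY : Measurable[mB] Y) (x : Cube D)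
    {s S : Set Ω} (hs : MeasurableSet[mA] s) (hS : MeasurableSet[mA ⊔ mF] S) :
    |∑ y, ipSign x y * μ.real (s ∩ Y ⁻¹' {y} ∩ S)| ≤
      ∫ ω, |fourier (condLaw μ mF Y ω) x| * (μ⟦s | mF⟧) ω ∂μ := by
  have hsS : MeasurableSet[mA ⊔ mF] (s ∩ S) :=
    MeasurableSet.inter ((le_sup_left : mA ≤ mA ⊔ mF) s hs) hS
  have measureReal_eq (y : Cube D) :
      μ.real (s ∩ Y ⁻¹' {y} ∩ S) = ∫ ω in s ∩ S, condLaw μ mF Y ω y ∂μ := by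
    have hy : MeasurableSet[mB] (Y ⁻¹' {y}) := hY (measurableSet_singleton y)
    rw [Set.inter_right_comm, Set.inter_comm,
      ← setIntegral_condExp_indicator_one (sup_le hA hF) (hB _ hy) hsS]
    exact setIntegral_congr_ae (sup_le hA hF _ hsS)
      ((condExp_sup_ae_eq_of_condIndep hA hB h hy).mono fun ω hω _ => hω)
  have abs_integrable : Integrable (fun ω => |fourier (condLaw μ mF Y ω) x|) μ :=
    (integrable_fourier_condLaw Y x).abs
  calc |∑ y, ipSign x y * μ.real (s ∩ Y ⁻¹' {y} ∩ S)|
      = |∫ ω in s ∩ S, fourier (condLaw μ mF Y ω) x ∂μ| := by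
        simp only [fourier]
        rw [integral_finsetSum _ fun y _ =>
          ((integrable_condLaw Y y).const_mul (ipSign x y)).integrableOn]
        simp only [measureReal_eq, integral_const_mul]
    _ ≤ ∫ ω in s ∩ S, |fourier (condLaw μ mF Y ω) x| ∂μ := abs_integral_le_integral_abs
    _ ≤ ∫ ω in s, |fourier (condLaw μ mF Y ω) x| ∂μ :=
        setIntegral_mono_set abs_integrable.integrableOn (ae_of_all _ fun _ => abs_nonneg _)
          Set.inter_subset_left.eventuallyLE
    _ = ∫ ω, |fourier (condLaw μ mF Y ω) x| * (μ⟦s | mF⟧) ω ∂μ :=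
        setIntegral_eq_integral_mul_condExp hF (hA s hs)
          (stronglyMeasurable_abs_fourier_condLaw Y x) abs_integrable

theorem abs_sum_sum_ipSign_mul_measureReal_le_left {hF : mF ≤ mΩ} (hA : mA ≤ mΩ) (hB : mB ≤ mΩ)
    (h : CondIndep mF mA mB hF μ) (hE : 1 ≤ E) {X Y : Ω → Cube D} (hX : Measurable[mA] X)
    (hY : Measurable[mB] Y)
    (hdpX : ∀ x y j u, MeasurableSet[mF] u → μ.real (X ⁻¹' {x} ∩ Y ⁻¹' {y} ∩ u) ≤
      E * μ.real (X ⁻¹' {flipAt j x} ∩ Y ⁻¹' {y} ∩ u) + δ)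
    (hdpY : ∀ x y j u, MeasurableSet[mF] u → μ.real (X ⁻¹' {x} ∩ Y ⁻¹' {y} ∩ u) ≤
      E * μ.real (X ⁻¹' {x} ∩ Y ⁻¹' {flipAt j y} ∩ u) + δ)
    {S : Set Ω} (hS : MeasurableSet[mA ⊔ mF] S) :
    |∑ x, ∑ y, ipSign x y * μ.real (X ⁻¹' {x} ∩ Y ⁻¹' {y} ∩ S)| ≤
      √(contraction (2 * E)) ^ D + 8 * D * 4 ^ D * δ := by
  have hXΩ : Measurable X := hX.mono hA le_rfl
  have hYΩ : Measurable Y := hY.mono hB le_rfl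
  have defectX_le : ∫ ω, ratioDefect E (condLaw μ mF X ω) ∂μ ≤ D * 4 ^ D * δ :=
    integral_ratioDefect_condLaw_le hF hXΩ hYΩ fun x y j u hu => by
      simpa only [setIntegral_condLaw_mul_condLaw hA hB h hX hY _ _ hu] using hdpX x y j u hu
  have defectY_le : ∫ ω, ratioDefect E (condLaw μ mF Y ω) ∂μ ≤ D * 4 ^ D * δ :=
    integral_ratioDefect_condLaw_le hF hYΩ hXΩ fun y x j u hu => by
      simpa only [mul_comm (condLaw μ mF Y _ _),
        setIntegral_condLaw_mul_condLaw hA hB h hX hY _ _ hu] using hdpY x y j u hu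
  calc |∑ x, ∑ y, ipSign x y * μ.real (X ⁻¹' {x} ∩ Y ⁻¹' {y} ∩ S)|
      ≤ ∑ x, |∑ y, ipSign x y * μ.real (X ⁻¹' {x} ∩ Y ⁻¹' {y} ∩ S)| :=
        Finset.abs_sum_le_sum_abs _ _
    _ ≤ ∑ x, ∫ ω, |fourier (condLaw μ mF Y ω) x| * condLaw μ mF X ω x ∂μ :=
        Finset.sum_le_sum fun x _ => abs_sum_ipSign_mul_measureReal_le hA hB h hY x
          (hX (measurableSet_singleton x)) hS
    _ = ∫ ω, ∑ x, condLaw μ mF X ω x * |fourier (condLaw μ mF Y ω) x| ∂μ := by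
        rw [integral_finsetSum _ fun x _ => integrable_condLaw_mul hF hXΩ x
          (integrable_fourier_condLaw Y x).abs]
        simp only [mul_comm]
    _ ≤ √(contraction (2 * E)) ^ D + 8 * D * 4 ^ D * δ := by
        linarith [integral_sum_condLaw_mul_abs_fourier_le hF hE hXΩ hYΩ (μ := μ)]

theorem abs_sum_sum_ipSign_mul_measureReal_le_right {hF : mF ≤ mΩ} (hA : mA ≤ mΩ) (hB : mB ≤ mΩ)
    (h : CondIndep mF mA mB hF μ) (hE : 1 ≤ E) {X Y : Ω → Cube D} (hX : Measurable[mA] X)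
    (hY : Measurable[mB] Y)
    (hdpX : ∀ x y j u, MeasurableSet[mF] u → μ.real (X ⁻¹' {x} ∩ Y ⁻¹' {y} ∩ u) ≤
      E * μ.real (X ⁻¹' {flipAt j x} ∩ Y ⁻¹' {y} ∩ u) + δ)
    (hdpY : ∀ x y j u, MeasurableSet[mF] u → μ.real (X ⁻¹' {x} ∩ Y ⁻¹' {y} ∩ u) ≤
      E * μ.real (X ⁻¹' {x} ∩ Y ⁻¹' {flipAt j y} ∩ u) + δ)
    {S : Set Ω} (hS : MeasurableSet[mB ⊔ mF] S) :
    |∑ x, ∑ y, ipSign x y * μ.real (X ⁻¹' {x} ∩ Y ⁻¹' {y} ∩ S)| ≤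
      √(contraction (2 * E)) ^ D + 8 * D * 4 ^ D * δ := by
  have swapped := abs_sum_sum_ipSign_mul_measureReal_le_left hB hA h.symm hE hY hX
    (fun y x j u hu => by simpa only [Set.inter_comm] using hdpY x y j u hu)
    (fun y x j u hu => by simpa only [Set.inter_comm] using hdpX x y j u hu) hS
  rw [Finset.sum_comm] at swapped
  simpa only [ipSign_comm, Set.inter_comm (Y ⁻¹' _)] using swapped

end InnerProductBias

section Seeds

lemma comap_snoc {Ω M : Type*} [MeasurableSpace M] {k : ℕ} (f : Ω → Fin k → M) (g : Ω → M) :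
    MeasurableSpace.comap (fun ω => (Fin.snoc (f ω) (g ω) : Fin (k + 1) → M)) inferInstance =
      MeasurableSpace.comap f inferInstance ⊔ MeasurableSpace.comap g inferInstance := by
  let F : Ω → Fin (k + 1) → M := fun ω => Fin.snoc (f ω) (g ω)
  have hF (i : Fin (k + 1)) : Measurable[MeasurableSpace.comap F inferInstance] fun ω => F ω i :=
    (measurable_pi_apply i).comp (comap_measurable F)
  refine le_antisymm (Measurable.comap_le ?_) (sup_le (Measurable.comap_le ?_)
    (Measurable.comap_le ?_))
  · refine @measurable_pi_lambda _ _ _ (_) _ _ fun i => ?_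
    induction i using Fin.lastCases with
    | last => simpa using (comap_measurable g).mono le_sup_right le_rfl
    | cast j =>
      simpa [Function.comp_def] using
        ((measurable_pi_apply j).comp (comap_measurable f)).mono le_sup_left le_rfl
  · refine @measurable_pi_lambda _ _ _ (_) _ _ fun j => ?_
    simpa [F] using hF j.castSucc
  · simpa [F] using hF (Fin.last k)

lemma measurable_comap_sup_comap {Ω α C N M : Type*} [MeasurableSpace α] [Countable α]
    [MeasurableSingletonClass α] [MeasurableSpace C] [MeasurableSpace N] [MeasurableSpace M]
    {g : α → C → N → M} (hg : ∀ a, Measurable fun p : C × N => g a p.1 p.2)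
    (S : Ω → α × C) (W : Ω → N) :
    Measurable[MeasurableSpace.comap S inferInstance ⊔ MeasurableSpace.comap W inferInstance]
      fun ω => g (S ω).1 (S ω).2 (W ω) := by
  have hS : Measurable[MeasurableSpace.comap S inferInstance ⊔
      MeasurableSpace.comap W inferInstance] S := (comap_measurable S).mono le_sup_left le_rfl
  have hW : Measurable[MeasurableSpace.comap S inferInstance ⊔
      MeasurableSpace.comap W inferInstance] W := (comap_measurable W).mono le_sup_right le_rfl
  have hg' : Measurable fun p : α × (C × N) => g p.1 p.2.1 p.2.2 :=
    measurable_from_prod_countable_right hg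
  exact hg'.comp ((measurable_fst.comp hS).prodMk ((measurable_snd.comp hS).prodMk hW))

lemma prod_restrict_singleton_prod_univ {α C : Type*} [MeasurableSpace α]
    [MeasurableSingletonClass α] [MeasurableSpace C] (ρ : Measure α) (ν : Measure C)
    [SFinite ρ] [SFinite ν] (x : α) :
    (ρ.prod ν).restrict ({x} ×ˢ Set.univ) = ρ {x} • ν.map (Prod.mk x) := by
  rw [← Measure.prod_restrict, Measure.restrict_univ, Measure.restrict_singleton,
    Measure.prod_smul_left, Measure.dirac_prod]

lemma measureReal_prod_prod_inter {α α' C C' : Type*} [MeasurableSpace α]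
    [MeasurableSingletonClass α] [MeasurableSpace α'] [MeasurableSingletonClass α']
    [MeasurableSpace C] [MeasurableSpace C'] (ρ : Measure α) (ρ' : Measure α') (ν : Measure C)
    (ν' : Measure C') [SFinite ρ] [SFinite ρ'] [SFinite ν] [SFinite ν'] (x : α) (y : α')
    {S : Set ((α × C) × (α' × C'))} (hS : MeasurableSet S) :
    ((ρ.prod ν).prod (ρ'.prod ν')).real
        ((fun ω => ω.1.1) ⁻¹' {x} ∩ (fun ω => ω.2.1) ⁻¹' {y} ∩ S) =
      ρ.real {x} * ρ'.real {y} * (ν.prod ν').real {r | ((x, r.1), (y, r.2)) ∈ S} := by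
  have hxy : ((fun ω : (α × C) × (α' × C') => ω.1.1) ⁻¹' {x} ∩ (fun ω => ω.2.1) ⁻¹' {y}) =
      ({x} ×ˢ Set.univ) ×ˢ ({y} ×ˢ Set.univ) := by
    ext ω; simp
  rw [hxy, Set.inter_comm, measureReal_def, ← Measure.restrict_apply hS, ← Measure.prod_restrict,
    prod_restrict_singleton_prod_univ, prod_restrict_singleton_prod_univ, Measure.prod_smul_left,
    Measure.prod_smul_right, smul_smul, Measure.smul_apply,
    Measure.map_prod_map _ _ measurable_prodMk_left measurable_prodMk_left,
    Measure.map_apply (measurable_prodMk_left.prodMap measurable_prodMk_left) hS, smul_eq_mul,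
    ENNReal.toReal_mul, ENNReal.toReal_mul]
  rfl

/-- The encoding `e` maps any two points of the cube that differ in one coordinate to neighbouring
datasets. -/
def NeighbourPreserving {D : ℕ} {ι 𝒳 : Type} (e : Cube D → ι → 𝒳) : Prop :=
  ∀ x j, Neighbouring (e x) (e (flipAt j x))

/-- The quantity `F`, for instance the probability that a party accepts, predicts the inner product
modulo 2 of uniformly random points of the cube with advantage at most `η`, whatever the encodings
of these points by datasets. -/
def HidesInnerProduct {ι 𝒳 : Type} (D : ℕ) (η : ℝ) (F : (ι → 𝒳) → (ι → 𝒳) → ℝ) : Prop :=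
  ∀ eA eB : Cube D → ι → 𝒳, NeighbourPreserving eA → NeighbourPreserving eB →
    |∑ x, ∑ y, ipSign x y * F (eA x) (eB y)| ≤ 4 ^ D * η

namespace Protocol

variable {𝒳 : Type} {n : ℕ} (P : Protocol 𝒳 n) {D : ℕ}

/-- The seed of each party consists of a point of the cube, which encodes its input, and of its
private randomness. -/
abbrev Seeds (D : ℕ) : Type := (Cube D × P.CoinsA) × (Cube D × P.CoinsB)

/-- The law of the seeds when the two points of the cube are uniform. -/
noncomputable def seedLaw (D : ℕ) : Measure (P.Seeds D) :=
  ((uniformOn Set.univ).prod P.lawA).prod ((uniformOn Set.univ).prod P.lawB)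

instance : IsProbabilityMeasure (P.seedLaw D) := by
  unfold seedLaw; infer_instance

/-- The σ-algebra of the seed of `A`. -/
abbrev seedSpaceA (D : ℕ) : MeasurableSpace (P.Seeds D) :=
  MeasurableSpace.comap Prod.fst inferInstance

/-- The σ-algebra of the seed of `B`. -/
abbrev seedSpaceB (D : ℕ) : MeasurableSpace (P.Seeds D) :=
  MeasurableSpace.comap Prod.snd inferInstance

lemma seedSpaceA_le : P.seedSpaceA D ≤ Prod.instMeasurableSpace := measurable_fst.comap_le

lemma seedSpaceB_le : P.seedSpaceB D ≤ Prod.instMeasurableSpace := measurable_snd.comap_le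

lemma measureReal_seedLaw_inter (x y : Cube D) {S : Set (P.Seeds D)} (hS : MeasurableSet S) :
    (P.seedLaw D).real ((fun ω => ω.1.1) ⁻¹' {x} ∩ (fun ω => ω.2.1) ⁻¹' {y} ∩ S) =
      (1 / 4) ^ D * P.law.real {r | ((x, r.1), (y, r.2)) ∈ S} := by
  have hcard (z : Cube D) : (uniformOn Set.univ).real {z} = (1 / 2 : ℝ) ^ D := by
    simp [measureReal_def, uniformOn_univ]
  rw [seedLaw, measureReal_prod_prod_inter _ _ _ _ x y hS, hcard, hcard, ← mul_pow]
  norm_num [law]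

section Messages

variable (eA eB : Cube D → Fin n → 𝒳)

/-- The first `k` messages as a function of the seeds. -/
def seedMessages (k : ℕ) (ω : P.Seeds D) : Fin k → P.Msg :=
  P.messages (eA ω.1.1) (eB ω.2.1) (ω.1.2, ω.2.2) k

/-- The σ-algebra of the first `k` messages. -/
abbrev messageSpace (k : ℕ) : MeasurableSpace (P.Seeds D) :=
  MeasurableSpace.comap (P.seedMessages eA eB k) inferInstance

lemma messageSpace_zero : P.messageSpace eA eB 0 = ⊥ := by
  have hconst : P.seedMessages eA eB 0 = fun _ => Fin.elim0 := rfl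
  rw [messageSpace, hconst, MeasurableSpace.comap_const]

lemma exists_messageSpace_succ (k : ℕ) : ∃ m,
    P.messageSpace eA eB (k + 1) = P.messageSpace eA eB k ⊔ m ∧
      (m ≤ P.seedSpaceA D ⊔ P.messageSpace eA eB k ∨
        m ≤ P.seedSpaceB D ⊔ P.messageSpace eA eB k) := by
  by_cases hk : Even k
  · refine ⟨_, ?_, .inl (measurable_comap_sup_comap (fun x => P.measurable_sendA k (eA x))
      Prod.fst (P.seedMessages eA eB k)).comap_le⟩
    rw [← comap_snoc, messageSpace]
    congr 1 with ω : 1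
    simp only [seedMessages, messages, hk, if_true]
  · refine ⟨_, ?_, .inr (measurable_comap_sup_comap (fun y => P.measurable_sendB k (eB y))
      Prod.snd (P.seedMessages eA eB k)).comap_le⟩
    rw [← comap_snoc, messageSpace]
    congr 1 with ω : 1
    simp only [seedMessages, messages, hk, if_false]

lemma messageSpace_le (k : ℕ) : P.messageSpace eA eB k ≤ Prod.instMeasurableSpace := by
  induction k with
  | zero => rw [messageSpace_zero]; exact bot_le
  | succ k ih =>
    obtain ⟨m, hm, hA | hB⟩ := P.exists_messageSpace_succ eA eB k
    · exact hm ▸ sup_le ih (hA.trans (sup_le P.seedSpaceA_le ih))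
    · exact hm ▸ sup_le ih (hB.trans (sup_le P.seedSpaceB_le ih))

lemma condIndep_messageSpace (k : ℕ) :
    CondIndep (P.messageSpace eA eB k) (P.seedSpaceA D) (P.seedSpaceB D)
      (P.messageSpace_le eA eB k) (P.seedLaw D) := by
  induction k with
  | zero =>
    simp only [messageSpace_zero]
    exact condIndep_bot_of_indep P.seedSpaceA_le P.seedSpaceB_le
      (indepFun_prod measurable_id measurable_id).symm
  | succ k ih =>
    obtain ⟨m, hm, hA | hB⟩ := P.exists_messageSpace_succ eA eB k
    · simpa only [hm] using condIndep_sup_of_le_sup_left P.seedSpaceA_le P.seedSpaceB_le ih hA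
    · simpa only [hm] using condIndep_sup_of_le_sup_right P.seedSpaceA_le P.seedSpaceB_le ih hB

end Messages

variable {eA eB : Cube D → Fin n → 𝒳} [MeasurableSpace 𝒳] {ε ε' δ : ℝ} {P}

lemma IsTwoPartyDP.mono (hP : P.IsTwoPartyDP ε δ) (h : ε ≤ ε') : P.IsTwoPartyDP ε' δ := by
  refine ⟨fun X Y Y' hY S hS => (hP.1 X Y Y' hY S hS).trans ?_,
    fun Y X X' hX S hS => (hP.2 Y X X' hX S hS).trans ?_⟩ <;> gcongr

lemma IsTwoPartyDP.measureReal_seedLaw_le_left (hP : P.IsTwoPartyDP ε δ)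
    (hA : NeighbourPreserving eA) (x y : Cube D) (j : Fin D) (u : Set (P.Seeds D))
    (hu : MeasurableSet[P.messageSpace eA eB P.rounds] u) :
    (P.seedLaw D).real ((fun ω => ω.1.1) ⁻¹' {x} ∩ (fun ω => ω.2.1) ⁻¹' {y} ∩ u) ≤
      Real.exp ε * (P.seedLaw D).real
        ((fun ω => ω.1.1) ⁻¹' {flipAt j x} ∩ (fun ω => ω.2.1) ⁻¹' {y} ∩ u) +
      (1 / 4) ^ D * δ := by
  have hum := P.messageSpace_le eA eB P.rounds u hu
  obtain ⟨T, hT, rfl⟩ := hu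
  have hdp := hP.2 (eB y) _ _ (hA x j) {v | v.2.2 ∈ T} (measurable_snd.snd hT)
  rw [P.measureReal_seedLaw_inter _ _ hum, P.measureReal_seedLaw_inter _ _ hum, mul_left_comm,
    ← mul_add]
  exact mul_le_mul_of_nonneg_left hdp (by positivity)

lemma IsTwoPartyDP.measureReal_seedLaw_le_right (hP : P.IsTwoPartyDP ε δ)
    (hB : NeighbourPreserving eB) (x y : Cube D) (j : Fin D) (u : Set (P.Seeds D))
    (hu : MeasurableSet[P.messageSpace eA eB P.rounds] u) :
    (P.seedLaw D).real ((fun ω => ω.1.1) ⁻¹' {x} ∩ (fun ω => ω.2.1) ⁻¹' {y} ∩ u) ≤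
      Real.exp ε * (P.seedLaw D).real
        ((fun ω => ω.1.1) ⁻¹' {x} ∩ (fun ω => ω.2.1) ⁻¹' {flipAt j y} ∩ u) +
      (1 / 4) ^ D * δ := by
  have hum := P.messageSpace_le eA eB P.rounds u hu
  obtain ⟨T, hT, rfl⟩ := hu
  have hdp := hP.1 (eA x) _ _ (hB y j) {v | v.2.2 ∈ T} (measurable_snd.snd hT)
  rw [P.measureReal_seedLaw_inter _ _ hum, P.measureReal_seedLaw_inter _ _ hum, mul_left_comm,
    ← mul_add]
  exact mul_le_mul_of_nonneg_left hdp (by positivity)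

lemma IsTwoPartyDP.abs_sum_ipSign_mul_law_le (hP : P.IsTwoPartyDP ε δ) (hε : 0 ≤ ε)
    (hA : NeighbourPreserving eA) (hB : NeighbourPreserving eB) {S : Set (P.Seeds D)}
    (hS : MeasurableSet[P.seedSpaceA D ⊔ P.messageSpace eA eB P.rounds] S ∨
      MeasurableSet[P.seedSpaceB D ⊔ P.messageSpace eA eB P.rounds] S) :
    |∑ x, ∑ y, ipSign x y * P.law.real {r | ((x, r.1), (y, r.2)) ∈ S}| ≤
      4 ^ D * (√(contraction (2 * Real.exp ε)) ^ D + 8 * D * δ) := by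
  have hX : Measurable[P.seedSpaceA D] fun ω : P.Seeds D => ω.1.1 :=
    measurable_fst.comp (comap_measurable Prod.fst)
  have hY : Measurable[P.seedSpaceB D] fun ω : P.Seeds D => ω.2.1 :=
    measurable_fst.comp (comap_measurable Prod.snd)
  have hE : 1 ≤ Real.exp ε := Real.one_le_exp hε
  have hci := P.condIndep_messageSpace eA eB P.rounds
  have hMle := P.messageSpace_le eA eB P.rounds
  have hSm : MeasurableSet S := hS.elim (sup_le P.seedSpaceA_le hMle S)
    (sup_le P.seedSpaceB_le hMle S)
  have hbias : |∑ x, ∑ y, ipSign x y * ((1 / 4) ^ D * P.law.real {r | ((x, r.1), (y, r.2)) ∈ S})| ≤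
      √(contraction (2 * Real.exp ε)) ^ D + 8 * D * 4 ^ D * ((1 / 4) ^ D * δ) := by
    simp only [← P.measureReal_seedLaw_inter _ _ hSm]
    exact hS.elim
      (abs_sum_sum_ipSign_mul_measureReal_le_left P.seedSpaceA_le P.seedSpaceB_le hci hE hX hY
        (hP.measureReal_seedLaw_le_left hA) (hP.measureReal_seedLaw_le_right hB))
      (abs_sum_sum_ipSign_mul_measureReal_le_right P.seedSpaceA_le P.seedSpaceB_le hci hE hX hY
        (hP.measureReal_seedLaw_le_left hA) (hP.measureReal_seedLaw_le_right hB))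
  have h4 : (4 : ℝ) ^ D * (1 / 4) ^ D = 1 := by rw [← mul_pow]; norm_num
  calc |∑ x, ∑ y, ipSign x y * P.law.real {r | ((x, r.1), (y, r.2)) ∈ S}|
      = 4 ^ D * |∑ x, ∑ y,
          ipSign x y * ((1 / 4) ^ D * P.law.real {r | ((x, r.1), (y, r.2)) ∈ S})| := by
        simp only [mul_left_comm (ipSign _ _), ← Finset.mul_sum]
        rw [abs_mul, abs_of_pos (by positivity : (0 : ℝ) < (1 / 4) ^ D), ← mul_assoc, h4, one_mul]
    _ ≤ 4 ^ D * (√(contraction (2 * Real.exp ε)) ^ D + 8 * D * 4 ^ D * ((1 / 4) ^ D * δ)) :=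
        mul_le_mul_of_nonneg_left hbias (by positivity)
    _ = 4 ^ D * (√(contraction (2 * Real.exp ε)) ^ D + 8 * D * (4 ^ D * (1 / 4) ^ D) * δ) := by
        ring
    _ = 4 ^ D * (√(contraction (2 * Real.exp ε)) ^ D + 8 * D * δ) := by rw [h4, mul_one]

lemma IsTwoPartyDP.hidesInnerProduct_viewA (hP : P.IsTwoPartyDP ε δ) (hε : 0 ≤ ε)
    {T : Set P.ViewA} (hT : MeasurableSet T) :
    HidesInnerProduct D (√(contraction (2 * Real.exp ε)) ^ D + 8 * D * δ)
      fun X Y => P.law.real {r | P.viewA X Y r ∈ T} := by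
  intro eA eB hA hB
  have hS : MeasurableSet[P.seedSpaceA D ⊔ P.messageSpace eA eB P.rounds] {ω : P.Seeds D |
      P.viewA (eA ω.1.1) (eB ω.2.1) (ω.1.2, ω.2.2) ∈ T} :=
    measurable_comap_sup_comap (g := fun x c w => (eA x, c, w))
      (fun _ => measurable_const.prodMk measurable_id) Prod.fst (P.seedMessages eA eB P.rounds) hT
  simpa only [Set.mem_ofPred_eq, Prod.mk.eta] using
    hP.abs_sum_ipSign_mul_law_le hε hA hB (.inl hS)

lemma IsTwoPartyDP.hidesInnerProduct_viewB (hP : P.IsTwoPartyDP ε δ) (hε : 0 ≤ ε)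
    {T : Set P.ViewB} (hT : MeasurableSet T) :
    HidesInnerProduct D (√(contraction (2 * Real.exp ε)) ^ D + 8 * D * δ)
      fun X Y => P.law.real {r | P.viewB X Y r ∈ T} := by
  intro eA eB hA hB
  have hS : MeasurableSet[P.seedSpaceB D ⊔ P.messageSpace eA eB P.rounds] {ω : P.Seeds D |
      P.viewB (eA ω.1.1) (eB ω.2.1) (ω.1.2, ω.2.2) ∈ T} :=
    measurable_comap_sup_comap (g := fun y c w => (eB y, c, w))
      (fun _ => measurable_const.prodMk measurable_id) Prod.snd (P.seedMessages eA eB P.rounds) hT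
  simpa only [Set.mem_ofPred_eq, Prod.mk.eta] using
    hP.abs_sum_ipSign_mul_law_le hε hA hB (.inr hS)

end Protocol

end Seeds

section Hybrid

variable {Z : Type*} [Fintype Z]

/-- The expectation of `F` when its `m` arguments are independent with distribution `w`. -/
def productMean {m : ℕ} (w : Z → ℝ) (F : (Fin m → Z) → ℝ) : ℝ :=
  ∑ z, (∏ i, w (z i)) * F z

variable {w w' : Z → ℝ} {m : ℕ} {F : (Fin m → Z) → ℝ} {b η : ℝ}

lemma productMean_succ (w : Z → ℝ) (F : (Fin (m + 1) → Z) → ℝ) :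
    productMean w F = ∑ c, w c * productMean w fun z => F (Fin.cons c z) := by
  rw [productMean, ← (Fin.consEquiv fun _ => Z).sum_comp, Fintype.sum_prod_type]
  simp [productMean, Fin.consEquiv, Fin.prod_univ_succ, Finset.mul_sum, mul_assoc]

lemma productMean_sub (w : Z → ℝ) (F G : (Fin m → Z) → ℝ) :
    productMean w (fun z => F z - G z) = productMean w F - productMean w G := by
  simp only [productMean, mul_sub, Finset.sum_sub_distrib]

lemma productMean_sum (w : Z → ℝ) (a : Z → ℝ) (F : Z → (Fin m → Z) → ℝ) :
    productMean w (fun z => ∑ c, a c * F c z) = ∑ c, a c * productMean w (F c) := by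
  simp only [productMean, Finset.mul_sum]
  rw [Finset.sum_comm]
  exact Finset.sum_congr rfl fun _ _ => Finset.sum_congr rfl fun _ _ => mul_left_comm ..

lemma productMean_const (hw : w ∈ stdSimplex ℝ Z) (b : ℝ) :
    productMean w (fun _ : Fin m → Z => b) = b := by
  classical
  rw [productMean, ← Finset.sum_mul, ← Fintype.piFinset_univ,
    ← Finset.prod_univ_sum (fun _ => Finset.univ) (fun _ => w)]
  simp [hw.2]

lemma productMean_le (hw : w ∈ stdSimplex ℝ Z) (hF : ∀ z, (∀ i, w (z i) ≠ 0) → F z ≤ b) :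
    productMean w F ≤ b := by
  rw [← productMean_const (m := m) hw b]
  refine Finset.sum_le_sum fun z _ => ?_
  by_cases hz : ∏ i, w (z i) = 0
  · rw [hz, zero_mul, zero_mul]
  · exact mul_le_mul_of_nonneg_left
      (hF z fun i => Finset.prod_ne_zero_iff.1 hz i (Finset.mem_univ i))
      (Finset.prod_nonneg fun i _ => hw.1 _)

lemma le_productMean (hw : w ∈ stdSimplex ℝ Z) (hF : ∀ z, (∀ i, w (z i) ≠ 0) → b ≤ F z) :
    b ≤ productMean w F := by
  have h := productMean_le hw (F := fun z => b - F z) (b := 0) fun z hz => sub_nonpos.2 (hF z hz)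
  rwa [productMean_sub, productMean_const hw, sub_nonpos] at h

lemma abs_productMean_le (hw : w ∈ stdSimplex ℝ Z) (hF : ∀ z, |F z| ≤ b) :
    |productMean w F| ≤ b :=
  abs_le.2 ⟨le_productMean hw fun z _ => (abs_le.1 (hF z)).1,
    productMean_le hw fun z _ => (abs_le.1 (hF z)).2⟩

-- Hybrid argument: the `m` factors are replaced one at a time.
lemma abs_productMean_sub_productMean_le (hw : w ∈ stdSimplex ℝ Z) (hw' : w' ∈ stdSimplex ℝ Z)
    (hF : ∀ i z, |∑ c, (w' c - w c) * F (Function.update z i c)| ≤ η) :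
    |productMean w' F - productMean w F| ≤ m * η := by
  induction m with
  | zero => simp [productMean]
  | succ m ih =>
    have htail (c : Z) : |productMean w' (fun z => F (Fin.cons c z)) -
        productMean w (fun z => F (Fin.cons c z))| ≤ m * η :=
      ih fun i z => by simpa only [Fin.cons_update] using hF i.succ (Fin.cons c z)
    have hhead (z : Fin m → Z) : |∑ c, (w' c - w c) * F (Fin.cons c z)| ≤ η := by
      obtain ⟨c₀⟩ : Nonempty Z := not_isEmpty_iff.1 fun _ => by simpa using hw.2
      simpa only [Fin.update_cons_zero] using hF 0 (Fin.cons c₀ z)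
    have hsplit : productMean w' F - productMean w F =
        ∑ c, w' c * (productMean w' (fun z => F (Fin.cons c z)) -
          productMean w (fun z => F (Fin.cons c z))) +
        productMean w (fun z => ∑ c, (w' c - w c) * F (Fin.cons c z)) := by
      rw [productMean_succ, productMean_succ, productMean_sum, ← Finset.sum_add_distrib,
        ← Finset.sum_sub_distrib]
      exact Finset.sum_congr rfl fun _ _ => by ring
    have hmix : |∑ c, w' c * (productMean w' (fun z => F (Fin.cons c z)) -
        productMean w (fun z => F (Fin.cons c z)))| ≤ m * η := by
      calc _ ≤ ∑ c, w' c * (m * η) := by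
            refine (Finset.abs_sum_le_sum_abs _ _).trans (Finset.sum_le_sum fun c _ => ?_)
            rw [abs_mul, abs_of_nonneg (hw'.1 c)]
            exact mul_le_mul_of_nonneg_left (htail c) (hw'.1 c)
        _ = m * η := by rw [← Finset.sum_mul, hw'.2, one_mul]
    rw [hsplit, Nat.cast_succ, add_one_mul]
    exact (abs_add_le _ _).trans (add_le_add hmix (abs_productMean_le hw hhead))

end Hybrid

section SignWeight

variable {Z : Type*} [Fintype Z] {χ : Z → ℝ} {s η : ℝ}

/-- For a sign `χ` and `s = ±1`, the uniform distribution on the points where `χ` equals `s`. -/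
noncomputable def signWeight (χ : Z → ℝ) (s : ℝ) (c : Z) : ℝ :=
  (1 + s * χ c) / ∑ c', (1 + s * χ c')

lemma sum_one_add_mul (χ : Z → ℝ) (s : ℝ) :
    ∑ c, (1 + s * χ c) = Fintype.card Z + s * ∑ c, χ c := by
  simp [Finset.sum_add_distrib, Finset.mul_sum]

lemma half_card_le_sum_one_add_mul (hs : |s| ≤ 1)
    (hbal : |∑ c, χ c| ≤ Fintype.card Z * η) (hη : η ≤ 1 / 2) :
    (Fintype.card Z : ℝ) / 2 ≤ ∑ c, (1 + s * χ c) := by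
  have hsmul : |s * ∑ c, χ c| ≤ Fintype.card Z / 2 :=
    calc |s * ∑ c, χ c| = |s| * |∑ c, χ c| := abs_mul _ _
      _ ≤ 1 * |∑ c, χ c| := mul_le_mul_of_nonneg_right hs (abs_nonneg _)
      _ ≤ Fintype.card Z * η := by rwa [one_mul]
      _ ≤ Fintype.card Z * (1 / 2) := mul_le_mul_of_nonneg_left hη (Nat.cast_nonneg _)
      _ = Fintype.card Z / 2 := by ring
  rw [sum_one_add_mul]
  linarith [(abs_le.1 hsmul).1]

lemma eq_of_signWeight_ne_zero (hχ : ∀ c, |χ c| = 1) (hs : |s| = 1) {c : Z}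
    (h : signWeight χ s c ≠ 0) : χ c = s := by
  have hnum : 1 + s * χ c ≠ 0 := fun h0 => h (by rw [signWeight, h0, zero_div])
  rcases eq_or_eq_neg_of_abs_eq hs with rfl | rfl <;>
    rcases eq_or_eq_neg_of_abs_eq (hχ c) with hc | hc <;> simp_all

variable [Nonempty Z]

lemma signWeight_mem_stdSimplex (hχ : ∀ c, |χ c| ≤ 1) (hs : |s| ≤ 1)
    (hbal : |∑ c, χ c| ≤ Fintype.card Z * η) (hη : η ≤ 1 / 2) :
    signWeight χ s ∈ stdSimplex ℝ Z := by
  have hpos : 0 < ∑ c, (1 + s * χ c) :=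
    lt_of_lt_of_le (by positivity) (half_card_le_sum_one_add_mul hs hbal hη)
  refine ⟨fun c => div_nonneg ?_ hpos.le, ?_⟩
  · have hsχ : |s * χ c| ≤ 1 := by
      rw [abs_mul]; exact mul_le_one₀ hs (abs_nonneg _) (hχ c)
    linarith [(abs_le.1 hsχ).1]
  · simp only [signWeight]
    rw [← Finset.sum_div, div_self hpos.ne']

lemma sum_signWeight_mul_sub_average (hs : ∑ c, (1 + s * χ c) ≠ 0) (F : Z → ℝ) :
    ∑ c, signWeight χ s c * F c - (∑ c, F c) / Fintype.card Z =
      s * (Fintype.card Z * ∑ c, χ c * F c - (∑ c, χ c) * ∑ c, F c) /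
        (Fintype.card Z * ∑ c, (1 + s * χ c)) := by
  have hw : ∑ c, signWeight χ s c * F c =
      (∑ c, F c + s * ∑ c, χ c * F c) / ∑ c, (1 + s * χ c) := by
    rw [Finset.mul_sum, ← Finset.sum_add_distrib, Finset.sum_div]
    exact Finset.sum_congr rfl fun c _ => by rw [signWeight]; ring
  rw [hw, div_sub_div _ _ hs (Nat.cast_ne_zero.2 Fintype.card_ne_zero),
    mul_comm (Fintype.card Z : ℝ) (∑ c, (1 + s * χ c))]
  congr 1
  rw [sum_one_add_mul]
  ring

lemma abs_sum_signWeight_mul_sub_average_le (hs : |s| ≤ 1)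
    (hbal : |∑ c, χ c| ≤ Fintype.card Z * η) (hη : η ≤ 1 / 2) {F : Z → ℝ} (hF : ∀ c, |F c| ≤ 1)
    (hcorr : |∑ c, χ c * F c| ≤ Fintype.card Z * η) :
    |∑ c, signWeight χ s c * F c - (∑ c, F c) / Fintype.card Z| ≤ 4 * η := by
  set N : ℝ := (Fintype.card Z : ℝ)
  have hN : 0 < N := Nat.cast_pos.2 Fintype.card_pos
  have hη0 : 0 ≤ η := nonneg_of_mul_nonneg_right ((abs_nonneg _).trans hbal) hN
  have hhalf := half_card_le_sum_one_add_mul hs hbal hη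
  have hpos : 0 < ∑ c, (1 + s * χ c) := lt_of_lt_of_le (half_pos hN) hhalf
  have hFN : |∑ c, F c| ≤ N := (Finset.abs_sum_le_sum_abs _ _).trans
    ((Finset.sum_le_card_nsmul _ _ 1 fun c _ => hF c).trans_eq (by simp [N]))
  have hnum : |s * (N * ∑ c, χ c * F c - (∑ c, χ c) * ∑ c, F c)| ≤ 2 * N ^ 2 * η := by
    calc |s * (N * ∑ c, χ c * F c - (∑ c, χ c) * ∑ c, F c)|
        ≤ 1 * (|N * ∑ c, χ c * F c| + |(∑ c, χ c) * ∑ c, F c|) := by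
          rw [abs_mul]
          exact mul_le_mul hs (abs_sub _ _) (abs_nonneg _) zero_le_one
      _ ≤ 1 * (N * (N * η) + N * η * N) := by
          rw [abs_mul, abs_mul, abs_of_pos hN]
          gcongr
      _ = 2 * N ^ 2 * η := by ring
  rw [sum_signWeight_mul_sub_average hpos.ne', abs_div, abs_of_pos (mul_pos hN hpos),
    div_le_iff₀ (mul_pos hN hpos)]
  calc |s * (N * ∑ c, χ c * F c - (∑ c, χ c) * ∑ c, F c)| ≤ 2 * N ^ 2 * η := hnum
    _ = 4 * η * (N * (N / 2)) := by ring
    _ ≤ 4 * η * (N * ∑ c, (1 + s * χ c)) := by gcongr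

lemma abs_sum_signWeight_sub_signWeight_mul_le (hbal : |∑ c, χ c| ≤ Fintype.card Z * η)
    (hη : η ≤ 1 / 2) {F : Z → ℝ} (hF : ∀ c, |F c| ≤ 1)
    (hcorr : |∑ c, χ c * F c| ≤ Fintype.card Z * η) :
    |∑ c, (signWeight χ (-1) c - signWeight χ 1 c) * F c| ≤ 8 * η := by
  simp only [sub_mul, Finset.sum_sub_distrib]
  have hneg := abs_sum_signWeight_mul_sub_average_le (s := -1) (by simp) hbal hη hF hcorr
  have hone := abs_sum_signWeight_mul_sub_average_le (s := 1) (by simp) hbal hη hF hcorr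
  rw [abs_sub_comm] at hone
  exact (abs_sub_le _ _ _).trans ((add_le_add hneg hone).trans_eq (by ring))

end SignWeight

section Blocks

variable {n D : ℕ}

/-- The concatenation of `n / D` blocks of length `D`, padded with `false` to length `n`. -/
def concatBlocks (hD : 0 < D) (u : Fin (n / D) → Cube D) (k : Fin n) : Bool :=
  if h : (k : ℕ) / D < n / D then u ⟨k / D, h⟩ ⟨k % D, Nat.mod_lt _ hD⟩ else false

lemma mul_add_lt_of_lt_div (i : Fin (n / D)) (j : Fin D) : (i : ℕ) * D + j < n :=
  calc (i : ℕ) * D + j < (i + 1) * D := by rw [add_one_mul]; exact Nat.add_lt_add_left j.2 _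
    _ ≤ n / D * D := Nat.mul_le_mul_right D i.2
    _ ≤ n := Nat.div_mul_le_self n D

lemma concatBlocks_mul_add (hD : 0 < D) (u : Fin (n / D) → Cube D) (i : Fin (n / D))
    (j : Fin D) : concatBlocks hD u ⟨i * D + j, mul_add_lt_of_lt_div i j⟩ = u i j := by
  have hdiv : ((i : ℕ) * D + j) / D = i := by
    rw [mul_comm, Nat.mul_add_div hD, Nat.div_eq_of_lt j.2, add_zero]
  have hmod : ((i : ℕ) * D + j) % D = j := by
    rw [mul_comm, Nat.mul_add_mod, Nat.mod_eq_of_lt j.2]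
  simp [concatBlocks, hdiv, hmod]

lemma neighbourPreserving_concatBlocks_update (hD : 0 < D) (u : Fin (n / D) → Cube D)
    (i : Fin (n / D)) :
    NeighbourPreserving fun x => concatBlocks (n := n) hD (Function.update u i x) := by
  refine fun x j => ⟨⟨i * D + j, mul_add_lt_of_lt_div i j⟩, fun k hk => ?_⟩
  simp only [concatBlocks]
  split_ifs with h
  · by_cases hi : (⟨(k : ℕ) / D, h⟩ : Fin (n / D)) = i
    · have hj : (⟨(k : ℕ) % D, Nat.mod_lt _ hD⟩ : Fin D) ≠ j := by
        rintro rfl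
        subst hi
        exact hk (Fin.ext (Nat.div_add_mod' k D).symm)
      rw [hi, Function.update_self, Function.update_self, flipAt, Function.update_of_ne hj]
    · rw [Function.update_of_ne hi, Function.update_of_ne hi]
  · rfl

lemma sum_filter_div_eq {M : Type*} [AddCommMonoid M] (hD : 0 < D) (g : Fin n → M)
    (i : Fin (n / D)) :
    ∑ k ∈ (Finset.univ : Finset (Fin n)).filter (fun k : Fin n => (k : ℕ) / D = i), g k =
      ∑ j : Fin D, g ⟨i * D + j, mul_add_lt_of_lt_div i j⟩ := by
  symm
  refine Finset.sum_bij (fun j _ => ⟨i * D + j, mul_add_lt_of_lt_div i j⟩) ?_ ?_ ?_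
    fun _ _ => rfl
  · intro j _
    simp [mul_comm (i : ℕ) D, Nat.mul_add_div hD, Nat.div_eq_of_lt j.2]
  · intro j _ j' _ h
    simpa [Fin.ext_iff] using h
  · intro k hk
    refine ⟨⟨k % D, Nat.mod_lt _ hD⟩, Finset.mem_univ _, Fin.ext ?_⟩
    simp [← (Finset.mem_filter.1 hk).2, Nat.div_add_mod']

lemma natCast_mod_two_eq (a : ℕ) : ((a % 2 : ℕ) : ℝ) = (1 - (-1) ^ a) / 2 := by
  rcases Nat.even_or_odd a with ha | ha
  · simp [Nat.even_iff.1 ha, ha.neg_one_pow]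
  · norm_num [Nat.odd_iff.1 ha, ha.neg_one_pow]

lemma ipSign_eq_neg_one_pow (x y : Cube D) : ipSign x y = (-1) ^ ∑ j, (x j && y j).toNat := by
  rw [ipSign, ← Finset.prod_pow_eq_pow_sum]
  refine Finset.prod_congr rfl fun j _ => ?_
  cases x j && y j <;> simp

lemma blockInnerProduct_concatBlocks (hD : 0 < D) (u v : Fin (n / D) → Cube D) :
    blockInnerProduct n D (Fin.append (concatBlocks hD u) (concatBlocks hD v)) =
      ∑ i, (1 - ipSign (u i) (v i)) / 2 := by
  rw [blockInnerProduct, Finset.sum_range]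
  refine Finset.sum_congr rfl fun i _ => ?_
  rw [natCast_mod_two_eq, sum_filter_div_eq hD, ipSign_eq_neg_one_pow]
  simp only [Fin.append_left, Fin.append_right, concatBlocks_mul_add]

/-- The function of `n / D` pairs of blocks of length `D` obtained from a function `F` of two
inputs of length `n` by concatenating the blocks. -/
def blockwise (hD : 0 < D) (F : (Fin n → Bool) → (Fin n → Bool) → ℝ)
    (z : Fin (n / D) → Cube D × Cube D) : ℝ :=
  F (concatBlocks hD fun i => (z i).1) (concatBlocks hD fun i => (z i).2)

lemma HidesInnerProduct.abs_sum_ipSign_mul_blockwise_le {F : (Fin n → Bool) → (Fin n → Bool) → ℝ}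
    {η : ℝ} (hF : HidesInnerProduct D η F) (hD : 0 < D) (i : Fin (n / D))
    (z : Fin (n / D) → Cube D × Cube D) :
    |∑ c : Cube D × Cube D, ipSign c.1 c.2 * blockwise hD F (Function.update z i c)| ≤
      Fintype.card (Cube D × Cube D) * η := by
  have hcard : (Fintype.card (Cube D × Cube D) : ℝ) = 4 ^ D := by
    simp [← mul_pow]
  have hupdate (x y : Cube D) : blockwise hD F (Function.update z i (x, y)) =
      F (concatBlocks hD (Function.update (fun k => (z k).1) i x))
        (concatBlocks hD (Function.update (fun k => (z k).2) i y)) := by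
    unfold blockwise
    congr 2 with k <;> rcases eq_or_ne k i with rfl | hk <;> simp [*]
  rw [Fintype.sum_prod_type, hcard]
  simp only [hupdate]
  exact hF _ _ (neighbourPreserving_concatBlocks_update hD (fun k => (z k).1) i)
    (neighbourPreserving_concatBlocks_update hD (fun k => (z k).2) i)

lemma HidesInnerProduct.sub_le_of_blockInnerProduct {F : (Fin n → Bool) → (Fin n → Bool) → ℝ}
    {η p q : ℝ} (hone : HidesInnerProduct D η fun _ _ : Fin n → Bool => 1)
    (hF : HidesInnerProduct D η F) (hD : 0 < D) (hn : 0 < n / D) (hη : η ≤ 1 / 2)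
    (hF1 : ∀ X Y, |F X Y| ≤ 1)
    (hp : ∀ X Y, blockInnerProduct n D (Fin.append X Y) = 0 → p ≤ F X Y)
    (hq : ∀ X Y, blockInnerProduct n D (Fin.append X Y) = (n / D : ℕ) → F X Y ≤ q) :
    p - q ≤ (n / D : ℕ) * (8 * η) := by
  let χ : Cube D × Cube D → ℝ := fun c => ipSign c.1 c.2
  have hχ (c : Cube D × Cube D) : |χ c| = 1 := abs_ipSign _ _
  have hbal : |∑ c, χ c| ≤ Fintype.card (Cube D × Cube D) * η := by
    simpa [blockwise, χ] using hone.abs_sum_ipSign_mul_blockwise_le hD ⟨0, hn⟩ default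
  have hw (s : ℝ) (hs : |s| = 1) : signWeight χ s ∈ stdSimplex ℝ (Cube D × Cube D) :=
    signWeight_mem_stdSimplex (fun c => (hχ c).le) hs.le hbal hη
  have hval (s : ℝ) (hs : |s| = 1) (z : Fin (n / D) → Cube D × Cube D)
      (hz : ∀ i, signWeight χ s (z i) ≠ 0) :
      blockInnerProduct n D (Fin.append (concatBlocks hD fun i => (z i).1)
        (concatBlocks hD fun i => (z i).2)) = (n / D : ℕ) * ((1 - s) / 2) := by
    have hsign (i : Fin (n / D)) : ipSign (z i).1 (z i).2 = s :=
      eq_of_signWeight_ne_zero hχ hs (hz i)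
    simp [blockInnerProduct_concatBlocks, hsign]
  have habs : |(-1 : ℝ)| = 1 := by simp
  have hzero : p ≤ productMean (signWeight χ 1) (blockwise hD F) :=
    le_productMean (hw 1 abs_one) fun z hz => hp _ _ (by simp [hval 1 abs_one z hz])
  have hmax : productMean (signWeight χ (-1)) (blockwise hD F) ≤ q :=
    productMean_le (hw (-1) habs) fun z hz => hq _ _ (by rw [hval (-1) habs z hz]; ring)
  have hhybrid := abs_productMean_sub_productMean_le (hw 1 abs_one) (hw (-1) habs)
    (F := blockwise hD F) fun i z => abs_sum_signWeight_sub_signWeight_mul_le hbal hη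
      (fun c => hF1 _ _) (hF.abs_sum_ipSign_mul_blockwise_le hD i z)
  linarith [(abs_le.1 hhybrid).1]

end Blocks

section Computes

variable {𝒳 : Type} {n D : ℕ} {η κ β : ℝ}

lemma NeighbourPreserving.encode {e : Cube D → Fin n → Bool} (he : NeighbourPreserving e)
    (enc : Fin n → Bool → 𝒳) : NeighbourPreserving fun x k => enc k (e x k) := fun x j =>
  (he x j).imp fun _ hi k hk => congrArg (enc k) (hi k hk)

lemma HidesInnerProduct.encode {F : (Fin n → 𝒳) → (Fin n → 𝒳) → ℝ} (hF : HidesInnerProduct D η F)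
    (enc : Fin n → Bool → 𝒳) :
    HidesInnerProduct D η fun X Y => F (fun k => enc k (X k)) (fun k => enc k (Y k)) :=
  fun _ _ hA hB => hF _ _ (hA.encode enc) (hB.encode enc)

lemma measureReal_le_of_disjoint {Ω : Type*} [MeasurableSpace Ω] {μ : Measure Ω}
    [IsProbabilityMeasure μ] {S T : Set Ω} {p : ℝ} (hT : MeasurableSet T) (hST : Disjoint S T)
    (hS : p ≤ μ.real S) : μ.real T ≤ 1 - p := by
  have hunion : μ.real (S ∪ T) = μ.real S + μ.real T := measureReal_union hST hT
  have hle : μ.real (S ∪ T) ≤ 1 := measureReal_le_one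
  linarith

/-- `f` restricted to the inputs encoding bits by `enc` is `κ` times the block inner product. -/
def EncodesBlockInnerProduct (D : ℕ) (κ : ℝ) (enc : Fin n → Bool → 𝒳)
    (f : (Fin (n + n) → 𝒳) → ℝ) : Prop :=
  ∀ X Y : Fin n → Bool, f (Fin.append (fun k => enc k (X k)) (fun k => enc k (Y k))) =
    κ * blockInnerProduct n D (Fin.append X Y)

lemma not_forall_le_measureReal_abs_sub_le {Ω V : Type*} [MeasurableSpace Ω] [MeasurableSpace V]
    {μ : Measure Ω} [IsProbabilityMeasure μ] {view : (Fin n → 𝒳) → (Fin n → 𝒳) → Ω → V}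
    (hview : ∀ X Y, Measurable (view X Y))
    (hhides : ∀ T, MeasurableSet T → HidesInnerProduct D η fun X Y => μ.real {r | view X Y r ∈ T})
    {enc : Fin n → Bool → 𝒳} {f : (Fin (n + n) → 𝒳) → ℝ} (hf : EncodesBlockInnerProduct D κ enc f)
    (hD : 0 < D) (hn : 0 < n / D) (hη : (n / D : ℕ) * η < 0.1) (hβ : β < κ * (n / D : ℕ) / 2)
    {out : V → ℝ} (hout : Measurable out) :
    ¬ ∀ X Y, 0.9 ≤ μ.real {r | |out (view X Y r) - f (Fin.append X Y)| ≤ β} := by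
  intro hcomp
  have hη2 : η ≤ 1 / 2 := by
    have hm : (1 : ℝ) ≤ (n / D : ℕ) := Nat.one_le_cast.2 hn
    by_contra! h
    nlinarith
  let T : Set V := {v | out v ≤ κ * (n / D : ℕ) / 2}
  have hT : MeasurableSet T := measurableSet_le hout measurable_const
  have hone : HidesInnerProduct D η fun _ _ : Fin n → 𝒳 => 1 := by
    simpa using hhides Set.univ MeasurableSet.univ
  have hgap := (hone.encode enc).sub_le_of_blockInnerProduct ((hhides T hT).encode enc) hD hn hη2
    (p := 0.9) (q := 1 - 0.9)
    (fun X Y => by rw [abs_of_nonneg measureReal_nonneg]; exact measureReal_le_one)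
    (fun X Y h0 => by
      refine (hcomp (fun k => enc k (X k)) fun k => enc k (Y k)).trans
        (measureReal_mono fun r hr => ?_)
      simp only [T, Set.mem_ofPred_eq, hf X Y, h0, mul_zero, sub_zero] at hr ⊢
      exact (le_abs_self _).trans (hr.trans hβ.le))
    (fun X Y h0 => by
      refine measureReal_le_of_disjoint (hview _ _ hT) (Set.disjoint_left.2 fun r hr hr' => ?_)
        (hcomp (fun k => enc k (X k)) (fun k => enc k (Y k)))
      simp only [T, Set.mem_ofPred_eq, hf X Y, h0] at hr hr'
      linarith [(abs_le.1 hr).1])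
  linarith

namespace Protocol

variable {P : Protocol 𝒳 n}

instance : IsProbabilityMeasure P.law := by
  unfold law; infer_instance

lemma measurable_messages (X Y : Fin n → 𝒳) (k : ℕ) : Measurable fun r => P.messages X Y r k := by
  have hseed : Measurable (P.seedMessages (D := 0) (fun _ => X) (fun _ => Y) k) :=
    measurable_iff_comap_le.2 (P.messageSpace_le _ _ k)
  have hcoins : Measurable fun r : P.Coins =>
      (((default : Cube 0), r.1), ((default : Cube 0), r.2)) := by
    fun_prop
  exact hseed.comp hcoins

variable [MeasurableSpace 𝒳]

theorem IsTwoPartyDP.not_computes {ε δ : ℝ} (hP : P.IsTwoPartyDP ε δ) (hε : 0 ≤ ε) (hD : 0 < D)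
    (hn : 0 < n / D) (hη : (n / D : ℕ) * (√(contraction (2 * Real.exp ε)) ^ D + 8 * D * δ) < 0.1)
    {enc : Fin n → Bool → 𝒳} {f : (Fin (n + n) → 𝒳) → ℝ} (hf : EncodesBlockInnerProduct D κ enc f)
    (hβ : β < κ * (n / D : ℕ) / 2) : ¬ P.Computes f β := by
  rintro (⟨out, hout, hc⟩ | ⟨out, hout, hc⟩)
  · exact not_forall_le_measureReal_abs_sub_le
      (fun X Y => measurable_const.prodMk (measurable_fst.prodMk (measurable_messages X Y _)))
      (fun _ hT => hP.hidesInnerProduct_viewA hε hT) hf hD hn hη hβ hout hc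
  · exact not_forall_le_measureReal_abs_sub_le
      (fun X Y => measurable_const.prodMk (measurable_snd.prodMk (measurable_messages X Y _)))
      (fun _ hT => hP.hidesInnerProduct_viewB hε hT) hf hD hn hη hβ hout hc

end Protocol

end Computes

section Sensitivity

variable {n D : ℕ}

lemma neighbouring_update {ι 𝒳 : Type} [DecidableEq ι] (w : ι → 𝒳) (t : ι) (c : 𝒳) :
    Neighbouring w (Function.update w t c) :=
  ⟨t, fun _ hs => (Function.update_of_ne hs c w).symm⟩

lemma Neighbouring.exists_eq_update {ι 𝒳 : Type} [DecidableEq ι] {w w' : ι → 𝒳}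
    (h : Neighbouring w w') : ∃ t c, w' = Function.update w t c := by
  obtain ⟨t, ht⟩ := h
  exact ⟨t, w' t, Function.eq_update_iff.2 ⟨rfl, fun s hs => (ht s hs).symm⟩⟩

lemma hasSensitivity_of_forall_update {ι 𝒳 : Type} [DecidableEq ι] {f : (ι → 𝒳) → ℝ} {s : ℝ}
    (hle : ∀ w t c, |f w - f (Function.update w t c)| ≤ s)
    (hex : ∃ w t c, |f w - f (Function.update w t c)| = s) : HasSensitivity f s := by
  refine IsGreatest.isLUB ⟨?_, ?_⟩
  · obtain ⟨w, t, c, h⟩ := hex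
    exact ⟨w, _, neighbouring_update w t c, h.symm⟩
  · rintro _ ⟨w, w', hww', rfl⟩
    obtain ⟨t, c, rfl⟩ := hww'.exists_eq_update
    exact hle w t c

/-- The number of blocks of length `D`, among the first `n / D` ones, that contain an odd number of
positions `k` with `g k = true`. -/
noncomputable def blockParity (n D : ℕ) (g : Fin n → Bool) : ℝ :=
  ∑ i ∈ Finset.range (n / D),
    (((∑ k ∈ (Finset.univ : Finset (Fin n)).filter (fun k : Fin n => (k : ℕ) / D = i),
      (g k).toNat) % 2 : ℕ) : ℝ)

lemma blockInnerProduct_eq_blockParity (w : Fin (n + n) → Bool) :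
    blockInnerProduct n D w =
      blockParity n D fun k => w (Fin.castAdd n k) && w (Fin.natAdd n k) := rfl

lemma blockInnerProduct_append (X Y : Fin n → Bool) :
    blockInnerProduct n D (Fin.append X Y) = blockParity n D fun k => X k && Y k := by
  simp only [blockInnerProduct_eq_blockParity, Fin.append_left, Fin.append_right]

@[simp] lemma blockParity_false : blockParity n D (fun _ => false) = 0 := by
  simp [blockParity]

lemma abs_natCast_mod_two_sub_le (a b : ℕ) : |((a % 2 : ℕ) : ℝ) - (b % 2 : ℕ)| ≤ 1 := by
  rcases Nat.mod_two_eq_zero_or_one a with ha | ha <;>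
    rcases Nat.mod_two_eq_zero_or_one b with hb | hb <;> simp [ha, hb]

lemma abs_blockParity_sub_le_card {g g' : Fin n → Bool} (S : Finset (Fin n))
    (h : ∀ k ∉ S, g k = g' k) : |blockParity n D g - blockParity n D g'| ≤ S.card := by
  classical
  let B := S.image fun k : Fin n => (k : ℕ) / D
  rw [blockParity, blockParity, ← Finset.sum_sub_distrib]
  calc _ ≤ ∑ i ∈ Finset.range (n / D), if i ∈ B then (1 : ℝ) else 0 := by
        refine (Finset.abs_sum_le_sum_abs _ _).trans (Finset.sum_le_sum fun i _ => ?_)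
        split_ifs with hi
        · exact abs_natCast_mod_two_sub_le _ _
        · have hblock : ∀ k ∈ (Finset.univ : Finset (Fin n)).filter
              (fun k : Fin n => (k : ℕ) / D = i), (g k).toNat = (g' k).toNat := fun k hk => by
            rw [h k fun hkS => hi (Finset.mem_image.2 ⟨k, hkS, (Finset.mem_filter.1 hk).2⟩)]
          rw [Finset.sum_congr rfl hblock, sub_self, abs_zero]
    _ ≤ B.card := by
        rw [Finset.sum_boole]
        exact_mod_cast Finset.card_le_card fun i hi => (Finset.mem_filter.1 hi).2
    _ ≤ S.card := by exact_mod_cast Finset.card_image_le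

lemma blockParity_update_true {g : Fin n → Bool} {a : Fin n} (ha : (a : ℕ) / D < n / D)
    (h : ∀ k : Fin n, (k : ℕ) / D = a / D → g k = false) :
    blockParity n D (Function.update g a true) = blockParity n D g + 1 := by
  rw [← sub_eq_iff_eq_add', blockParity, blockParity, ← Finset.sum_sub_distrib,
    Finset.sum_eq_single_of_mem _ (Finset.mem_range.2 ha)]
  · have hg : ∑ k ∈ Finset.univ.filter (fun k : Fin n => (k : ℕ) / D = a / D), (g k).toNat = 0 :=
      Finset.sum_eq_zero fun k hk => by rw [h k (Finset.mem_filter.1 hk).2, Bool.toNat_false]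
    rw [Finset.sum_eq_single_of_mem a (by simp) fun k hk hka => by
      rw [Function.update_of_ne hka, h k (Finset.mem_filter.1 hk).2, Bool.toNat_false], hg]
    simp
  · intro i _ hi
    rw [sub_eq_zero, Finset.sum_congr rfl fun k hk => ?_]
    rw [Function.update_of_ne]
    rintro rfl
    exact hi (Finset.mem_filter.1 hk).2.symm

lemma append_update_right {α : Type*} {m : ℕ} (u : Fin m → α) (v : Fin n → α) (a : Fin n) (c : α) :
    Fin.append u (Function.update v a c) = Function.update (Fin.append u v) (Fin.natAdd m a) c := by
  refine Function.eq_update_iff.2 ⟨by simp, fun t ht => ?_⟩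
  induction t using Fin.addCases with
  | left k => simp only [Fin.append_left]
  | right k =>
    rw [Fin.append_right, Fin.append_right, Function.update_of_ne]
    exact fun h => ht (congrArg (Fin.natAdd m) h)

lemma pos_of_one_le_div (hn : 1 ≤ n / D) : 0 < n :=
  Nat.pos_of_ne_zero fun h => by simp [h] at hn

theorem hasSensitivity_blockInnerProduct (hn : 1 ≤ n / D) :
    HasSensitivity (blockInnerProduct n D) 1 := by
  refine hasSensitivity_of_forall_update (fun w t c => ?_) ?_
  · obtain ⟨a, ha⟩ : ∃ a : Fin n, t = Fin.castAdd n a ∨ t = Fin.natAdd n a := by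
      induction t using Fin.addCases with
      | left a => exact ⟨a, Or.inl rfl⟩
      | right a => exact ⟨a, Or.inr rfl⟩
    simp only [blockInnerProduct_eq_blockParity]
    refine (abs_blockParity_sub_le_card {a} fun k hk => ?_).trans (by simp)
    have hka : (k : ℕ) ≠ a := Fin.val_ne_of_ne (Finset.notMem_singleton.1 hk)
    have hcast : Fin.castAdd n k ≠ t := by
      rcases ha with rfl | rfl <;>
        simp only [ne_eq, Fin.ext_iff, Fin.val_castAdd, Fin.val_natAdd] <;> omega
    have hnat : Fin.natAdd n k ≠ t := by
      rcases ha with rfl | rfl <;>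
        simp only [ne_eq, Fin.ext_iff, Fin.val_castAdd, Fin.val_natAdd] <;> omega
    rw [Function.update_of_ne hcast, Function.update_of_ne hnat]
  · let a : Fin n := ⟨0, pos_of_one_le_div hn⟩
    let x : Fin n → Bool := Function.update (fun _ => false) a true
    have hx : blockParity n D x = 1 := by
      rw [blockParity_update_true ((Nat.zero_div D).trans_lt hn) fun _ _ => rfl, blockParity_false,
        zero_add]
    refine ⟨Fin.append x fun _ => false, Fin.natAdd n a, true, ?_⟩
    rw [← append_update_right, blockInnerProduct_append, blockInnerProduct_append]
    simp only [Bool.and_false, Bool.and_self, blockParity_false, hx, x]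
    norm_num

/-- The element of the domain `[2 n]` that encodes the bit `b` at position `k`. -/
def encodeBit (k : Fin n) (b : Bool) : Fin (2 * n) :=
  ⟨2 * k + b.toNat, by have := k.2; have := b.toNat_lt; omega⟩

lemma encodeBit_inj {k k' : Fin n} {b b' : Bool} :
    encodeBit k b = encodeBit k' b' ↔ k = k' ∧ b = b' := by
  refine ⟨fun h => ?_, fun h => by rw [h.1, h.2]⟩
  have hval : 2 * (k : ℕ) + b.toNat = 2 * k' + b'.toNat := congrArg Fin.val h
  cases b <;> cases b' <;> simp [Fin.ext_iff] at hval ⊢ <;> omega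

/-- The number of occurrences of `c` in the dataset `w`. -/
def occurrences {ι α : Type*} [Fintype ι] [DecidableEq α] (w : ι → α) (c : α) : ℕ :=
  ((Finset.univ : Finset ι).filter fun t => w t = c).card

lemma occurrences_comp_perm {ι α : Type*} [Fintype ι] [DecidableEq α] (w : ι → α)
    (σ : Equiv.Perm ι) (c : α) : occurrences (w ∘ σ) c = occurrences w c :=
  Finset.card_equiv σ (by simp)

lemma occurrences_update {ι α : Type*} [Fintype ι] [DecidableEq ι] [DecidableEq α] (w : ι → α)
    (t : ι) (c d : α) :
    occurrences (Function.update w t c) d + (if w t = d then 1 else 0) =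
      occurrences w d + if c = d then 1 else 0 := by
  simp only [occurrences, Finset.card_filter]
  rw [← Finset.add_sum_erase _ _ (Finset.mem_univ t),
    ← Finset.add_sum_erase _ (fun s => if w s = d then 1 else 0) (Finset.mem_univ t),
    Function.update_self, Finset.sum_congr rfl fun s hs => by
      rw [Function.update_of_ne (Finset.ne_of_mem_erase hs)]]
  ring

lemma occurrences_append_encodeBit (X Y : Fin n → Bool) (k : Fin n) :
    occurrences (Fin.append (fun k => encodeBit k (X k)) fun k => encodeBit k (Y k))
      (encodeBit k true) = (X k).toNat + (Y k).toNat := by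
  have hsingle (Z : Fin n → Bool) :
      (∑ t, if encodeBit t (Z t) = encodeBit k true then 1 else 0) = (Z k).toNat := by
    rw [Fintype.sum_eq_single k fun t ht => by simp [encodeBit_inj, ht]]
    cases Z k <;> simp [encodeBit_inj]
  rw [occurrences, Finset.card_filter, Fin.sum_univ_add]
  simp only [Fin.append_left, Fin.append_right, hsingle]

/-- Half the block parity of the set of positions whose bit `true` occurs exactly twice. Changing
one entry affects at most two positions; the factor `1 / 2` compensates for this. -/
noncomputable def symmetricParity (n D : ℕ) (w : Fin (n + n) → Fin (2 * n)) : ℝ :=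
  1 / 2 * blockParity n D fun k => decide (occurrences w (encodeBit k true) = 2)

lemma isSymmetric_symmetricParity : IsSymmetric (symmetricParity n D) := fun σ w => by
  simp only [symmetricParity, occurrences_comp_perm]

lemma encodesBlockInnerProduct_symmetricParity :
    EncodesBlockInnerProduct D (1 / 2) encodeBit (symmetricParity n D) := fun X Y => by
  rw [symmetricParity, blockInnerProduct_append]
  congr 2 with k
  rw [occurrences_append_encodeBit]
  cases X k <;> cases Y k <;> rfl

lemma abs_symmetricParity_sub_update_le (w : Fin (n + n) → Fin (2 * n)) (t : Fin (n + n))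
    (c : Fin (2 * n)) :
    |symmetricParity n D w - symmetricParity n D (Function.update w t c)| ≤ 1 := by
  let S : Finset (Fin n) :=
    Finset.univ.filter fun k => encodeBit k true ∈ ({w t, c} : Finset (Fin (2 * n)))
  have hcard : S.card ≤ 2 :=
    (Finset.card_le_card_of_injOn (fun k => encodeBit k true)
      (fun k hk => (Finset.mem_filter.1 hk).2)
      (fun k _ k' _ h => (encodeBit_inj.1 h).1)).trans Finset.card_le_two
  have hparity := abs_blockParity_sub_le_card (D := D)
    (g := fun k => decide (occurrences w (encodeBit k true) = 2))
    (g' := fun k => decide (occurrences (Function.update w t c) (encodeBit k true) = 2)) S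
    fun k hk => by
      have hk' : w t ≠ encodeBit k true ∧ c ≠ encodeBit k true := by
        simpa [S, eq_comm] using hk
      have hocc := occurrences_update w t c (encodeBit k true)
      rw [if_neg hk'.1, if_neg hk'.2, add_zero, add_zero] at hocc
      rw [hocc]
  have hcard' : (S.card : ℝ) ≤ 2 := by exact_mod_cast hcard
  rw [symmetricParity, symmetricParity, ← mul_sub, abs_mul, abs_of_pos one_half_pos]
  linarith

lemma symmetricParity_update_append_encodeBit {x : Fin n → Bool} {a b : Fin n} (hab : a ≠ b)
    (hx : ∀ k, x k = true ↔ k = a ∨ k = b) :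
    symmetricParity n D (Function.update
      (Fin.append (fun k => encodeBit k (x k)) fun k => encodeBit k (x k))
      (Fin.castAdd n b) (encodeBit a true)) = 0 := by
  have hne (k : Fin n) : occurrences (Function.update
      (Fin.append (fun k => encodeBit k (x k)) fun k => encodeBit k (x k))
      (Fin.castAdd n b) (encodeBit a true)) (encodeBit k true) ≠ 2 := by
    have hocc := occurrences_update
      (Fin.append (fun k => encodeBit k (x k)) fun k => encodeBit k (x k))
      (Fin.castAdd n b) (encodeBit a true) (encodeBit k true)
    rw [occurrences_append_encodeBit, Fin.append_left, (hx b).2 (Or.inr rfl)] at hocc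
    simp only [encodeBit_inj, and_true] at hocc
    by_cases hka : a = k
    · subst hka
      rw [(hx a).2 (Or.inl rfl), if_neg hab.symm, if_pos rfl, Bool.toNat_true] at hocc
      omega
    · by_cases hkb : b = k
      · rw [if_neg hka, if_pos hkb] at hocc
        omega
      · have hxk : x k = false :=
          Bool.eq_false_iff.2 fun h => ((hx k).1 h).elim (hka ∘ Eq.symm) (hkb ∘ Eq.symm)
        rw [if_neg hka, if_neg hkb, hxk, Bool.toNat_false] at hocc
        omega
  simp [symmetricParity, hne]

theorem hasSensitivity_symmetricParity (hD : 0 < D) (hn : 2 ≤ n / D) :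
    HasSensitivity (symmetricParity n D) 1 := by
  refine hasSensitivity_of_forall_update abs_symmetricParity_sub_update_le ?_
  have hDn : 2 * D ≤ n := (Nat.le_div_iff_mul_le hD).1 hn
  let a : Fin n := ⟨0, by omega⟩
  let b : Fin n := ⟨D, by omega⟩
  have hab : a ≠ b := fun h => hD.ne (congrArg Fin.val h)
  have hdiva : (a : ℕ) / D = 0 := Nat.zero_div D
  have hdivb : (b : ℕ) / D = 1 := Nat.div_self hD
  let x : Fin n → Bool := Function.update (Function.update (fun _ => false) a true) b true
  have hx (k : Fin n) : x k = true ↔ k = a ∨ k = b := by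
    by_cases hb : k = b <;> by_cases ha : k = a <;> simp [x, Function.update_apply, ha, hb]
  have hparity : blockParity n D x = 2 := by
    rw [blockParity_update_true (by omega) ?_, blockParity_update_true (by omega) fun _ _ => rfl,
      blockParity_false]
    · norm_num
    · refine fun k hk => Function.update_of_ne ?_ _ _
      rintro rfl
      omega
  refine ⟨Fin.append (fun k => encodeBit k (x k)) fun k => encodeBit k (x k), Fin.castAdd n b,
    encodeBit a true, ?_⟩
  rw [symmetricParity_update_append_encodeBit hab hx,
    encodesBlockInnerProduct_symmetricParity x x, blockInnerProduct_append]
  simp only [Bool.and_self, hparity]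
  norm_num

end Sensitivity

section BlockLength

variable {n D : ℕ} {C θ δ : ℝ}

lemma contraction_pos {G : ℝ} (hG : 1 ≤ G) : 0 < contraction G := by
  rw [contraction, sub_pos, div_lt_one (by positivity)]
  nlinarith [pow_nonneg (zero_le_one.trans hG) 3, sq_nonneg (G - 1)]

lemma contraction_lt_one {G : ℝ} (hG : 0 < G) : contraction G < 1 :=
  sub_lt_self 1 (by positivity)

/-- The length of the blocks: a multiple of `log n`, so that the leakage `θ ^ D` of one block is
polynomially small while the number of blocks is still of order `n / log n`. -/
noncomputable def blockLength (C : ℝ) (n : ℕ) : ℕ := ⌈C * Real.log n⌉₊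

lemma one_le_log_natCast (hn : 3 ≤ n) : 1 ≤ Real.log n := by
  have hn3 : (3 : ℝ) ≤ n := by exact_mod_cast hn
  rw [Real.le_log_iff_exp_le (by linarith)]
  linarith [Real.exp_one_lt_d9]

lemma eventually_mul_log_le (hC : 0 < C) : ∀ᶠ n : ℕ in Filter.atTop, C * Real.log n ≤ n := by
  filter_upwards [tendsto_natCast_atTop_atTop.eventually
    (Real.isLittleO_log_id_atTop.def (inv_pos.2 hC))] with n hn
  calc C * Real.log n ≤ C * (C⁻¹ * n) := by
        refine mul_le_mul_of_nonneg_left ((Real.le_norm_self _).trans ?_) hC.le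
        simpa using hn
    _ = n := mul_inv_cancel_left₀ hC.ne' _

lemma blockLength_pos (hC : 0 < C) (hn : 3 ≤ n) : 0 < blockLength C n :=
  Nat.ceil_pos.2 (mul_pos hC (one_pos.trans_le (one_le_log_natCast hn)))

lemma blockLength_le (hC : 0 < C) (hn : 3 ≤ n) : blockLength C n ≤ (C + 1) * Real.log n := by
  have hlog := one_le_log_natCast hn
  have hceil : (blockLength C n : ℝ) < C * Real.log n + 1 := Nat.ceil_lt_add_one (by positivity)
  linarith

lemma two_le_div_blockLength (hC : 0 < C) (hn : 3 ≤ n) (hlog : 2 * (C + 1) * Real.log n ≤ n) :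
    2 ≤ n / blockLength C n := by
  rw [Nat.le_div_iff_mul_le (blockLength_pos hC hn)]
  have hle : (2 * blockLength C n : ℝ) ≤ n := by linarith [blockLength_le hC hn]
  exact_mod_cast hle

lemma pow_blockLength_le (hθ0 : 0 < θ) (hθ1 : θ < 1) (hn : 0 < n) :
    θ ^ blockLength (2 / -Real.log θ) n ≤ 1 / (n : ℝ) ^ 2 := by
  have hlog : 0 < -Real.log θ := neg_pos.2 (Real.log_neg hθ0 hθ1)
  rw [one_div, ← Real.rpow_natCast, ← Real.log_le_log_iff (by positivity) (by positivity),
    Real.log_rpow hθ0, Real.log_inv, Real.log_pow]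
  have hceil : 2 / -Real.log θ * Real.log n ≤ blockLength (2 / -Real.log θ) n := Nat.le_ceil _
  have hmul := mul_le_mul_of_nonneg_right hceil hlog.le
  rw [mul_right_comm, div_mul_cancel₀ _ hlog.ne'] at hmul
  push_cast
  linarith

lemma div_mul_leakage_lt (hn : 21 ≤ n) (hθ : θ ^ D ≤ 1 / (n : ℝ) ^ 2) (hδ0 : 0 ≤ δ)
    (hδ : δ ≤ 1 / 200 / n) : (n / D : ℕ) * (θ ^ D + 8 * D * δ) < 0.1 := by
  have hn' : (21 : ℝ) ≤ n := by exact_mod_cast hn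
  have hn0 : (0 : ℝ) < n := by linarith
  have hdiv : ((n / D : ℕ) : ℝ) ≤ n := by exact_mod_cast Nat.div_le_self n D
  have hdivmul : ((n / D : ℕ) : ℝ) * D ≤ n := by exact_mod_cast Nat.div_mul_le_self n D
  have hpow : ((n / D : ℕ) : ℝ) * θ ^ D ≤ 1 / 21 :=
    calc ((n / D : ℕ) : ℝ) * θ ^ D ≤ (n / D : ℕ) * (1 / (n : ℝ) ^ 2) :=
          mul_le_mul_of_nonneg_left hθ (Nat.cast_nonneg _)
      _ ≤ n * (1 / (n : ℝ) ^ 2) := mul_le_mul_of_nonneg_right hdiv (by positivity)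
      _ = 1 / n := by field_simp
      _ ≤ 1 / 21 := one_div_le_one_div_of_le (by norm_num) hn'
  have hadd : ((n / D : ℕ) : ℝ) * D * δ ≤ 1 / 200 :=
    calc ((n / D : ℕ) : ℝ) * D * δ ≤ n * (1 / 200 / n) := mul_le_mul hdivmul hδ hδ0 hn0.le
      _ = 1 / 200 := by field_simp
  calc ((n / D : ℕ) : ℝ) * (θ ^ D + 8 * D * δ) =
        (n / D : ℕ) * θ ^ D + 8 * ((n / D : ℕ) * D * δ) := by ring
    _ ≤ 1 / 21 + 8 * (1 / 200) := by linarith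
    _ < 0.1 := by norm_num

lemma div_log_lt_div_blockLength (hC : 0 < C) (hn : 3 ≤ n) (hdiv : 1 ≤ n / blockLength C n) :
    n / Real.log n < 2 * (C + 1) * (n / blockLength C n : ℕ) := by
  have hlog : 0 < Real.log n := one_pos.trans_le (one_le_log_natCast hn)
  have hlt : (n : ℝ) < blockLength C n * ((n / blockLength C n : ℕ) + 1) := by
    exact_mod_cast Nat.lt_mul_div_succ n (blockLength_pos hC hn)
  have hdiv' : (1 : ℝ) ≤ (n / blockLength C n : ℕ) := by exact_mod_cast hdiv
  rw [div_lt_iff₀ hlog]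
  calc (n : ℝ) < blockLength C n * ((n / blockLength C n : ℕ) + 1) := hlt
    _ ≤ (C + 1) * Real.log n * (2 * (n / blockLength C n : ℕ)) :=
        mul_le_mul (blockLength_le hC hn) (by linarith) (by positivity) (by positivity)
    _ = 2 * (C + 1) * (n / blockLength C n : ℕ) * Real.log n := by ring

lemma exists_forall_blockLength (hθ0 : 0 < θ) (hθ1 : θ < 1) :
    ∃ c₁ : ℝ, 0 < c₁ ∧ ∃ c₂ : ℝ, 0 < c₂ ∧ ∃ N : ℕ, ∀ n : ℕ, N ≤ n →
      ∃ D : ℕ, 0 < D ∧ 2 ≤ n / D ∧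
        (∀ δ : ℝ, 0 ≤ δ → δ ≤ c₁ / n → (n / D : ℕ) * (θ ^ D + 8 * D * δ) < 0.1) ∧
        c₂ * (n / Real.log n) < (n / D : ℕ) / 4 := by
  let C : ℝ := 2 / -Real.log θ
  have hC : 0 < C := div_pos two_pos (neg_pos.2 (Real.log_neg hθ0 hθ1))
  obtain ⟨N, hN⟩ := Filter.eventually_atTop.1
    (eventually_mul_log_le (C := 2 * (C + 1)) (by positivity))
  refine ⟨1 / 200, by norm_num, 1 / (8 * (C + 1)), by positivity, max N 21, fun n hn => ?_⟩
  have hn21 : 21 ≤ n := (le_max_right _ _).trans hn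
  have hdiv : 2 ≤ n / blockLength C n :=
    two_le_div_blockLength hC (by omega) (hN n ((le_max_left _ _).trans hn))
  refine ⟨blockLength C n, blockLength_pos hC (by omega), hdiv, fun δ hδ0 hδ => ?_, ?_⟩
  · exact div_mul_leakage_lt hn21 (pow_blockLength_le hθ0 hθ1 (by omega)) hδ0 hδ
  · calc 1 / (8 * (C + 1)) * (n / Real.log n) <
          1 / (8 * (C + 1)) * (2 * (C + 1) * (n / blockLength C n : ℕ)) :=
          mul_lt_mul_of_pos_left (div_log_lt_div_blockLength hC (by omega) (by omega))
            (by positivity)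
      _ = (n / blockLength C n : ℕ) / 4 := by field_simp; norm_num

end BlockLength

theorem exists_forall_not_computes (ε₀ : ℝ) (hε₀ : 0 ≤ ε₀) :
    ∃ c₁ : ℝ, 0 < c₁ ∧ ∃ c₂ : ℝ, 0 < c₂ ∧ ∃ N : ℕ, ∀ n : ℕ, N ≤ n →
      ∃ D : ℕ, 0 < D ∧ 2 ≤ n / D ∧
        ∀ (𝒳 : Type) [MeasurableSpace 𝒳] (enc : Fin n → Bool → 𝒳) (f : (Fin (n + n) → 𝒳) → ℝ)
          (κ : ℝ), 1 / 2 ≤ κ → EncodesBlockInnerProduct D κ enc f →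
        ∀ ε δ β : ℝ, ε ≤ ε₀ → 0 ≤ δ → δ ≤ c₁ / n → β ≤ c₂ * (n / Real.log n) →
        ∀ P : Protocol 𝒳 n, P.IsTwoPartyDP ε δ → ¬ P.Computes f β := by
  have hG : 1 ≤ 2 * Real.exp ε₀ := by linarith [Real.one_le_exp hε₀]
  have hθ0 : 0 < √(contraction (2 * Real.exp ε₀)) := Real.sqrt_pos.2 (contraction_pos hG)
  have hθ1 : √(contraction (2 * Real.exp ε₀)) < 1 := by
    rw [Real.sqrt_lt' one_pos, one_pow]
    exact contraction_lt_one (one_pos.trans_le hG)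
  obtain ⟨c₁, hc₁, c₂, hc₂, N, hN⟩ := exists_forall_blockLength hθ0 hθ1
  refine ⟨c₁, hc₁, c₂, hc₂, N, fun n hn => ?_⟩
  obtain ⟨D, hD, hdiv, hleak, herr⟩ := hN n hn
  refine ⟨D, hD, hdiv, fun 𝒳 _ enc f κ hκ hf ε δ β hε hδ0 hδ hβ P hP => ?_⟩
  refine (hP.mono hε).not_computes hε₀ hD (two_pos.trans_le hdiv) (hleak δ hδ0 hδ) hf
    (hβ.trans_lt (herr.trans_le ?_))
  have hκdiv := mul_le_mul_of_nonneg_right hκ (Nat.cast_nonneg (α := ℝ) (n / D))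
  linarith

end TwoPartyDP

theorem theorem10 (ε₀ : ℝ) (hε₀ : 0 ≤ ε₀) :
    (∃ c₁ : ℝ, 0 < c₁ ∧ ∃ c₂ : ℝ, 0 < c₂ ∧ ∃ N : ℕ, ∀ n : ℕ, N ≤ n →
      ∃ f : (Fin (n + n) → Bool) → ℝ,
        (∃ D : ℕ, 1 ≤ D ∧ f = TwoPartyDP.blockInnerProduct n D) ∧
        TwoPartyDP.HasSensitivity f 1 ∧
        ∀ ε δ β : ℝ, 0 ≤ ε → ε ≤ ε₀ → 0 ≤ δ → δ ≤ c₁ / n → β ≤ c₂ * (n / Real.log n) →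
          ∀ P : TwoPartyDP.Protocol Bool n, P.IsTwoPartyDP ε δ → ¬ P.Computes f β) ∧
    (∃ c₁ : ℝ, 0 < c₁ ∧ ∃ c₂ : ℝ, 0 < c₂ ∧ ∃ N : ℕ, ∀ n : ℕ, N ≤ n →
      ∃ f : (Fin (n + n) → Fin (2 * n)) → ℝ,
        TwoPartyDP.IsSymmetric f ∧
        TwoPartyDP.HasSensitivity f 1 ∧
        ∀ ε δ β : ℝ, 0 ≤ ε → ε ≤ ε₀ → 0 ≤ δ → δ ≤ c₁ / n → β ≤ c₂ * (n / Real.log n) →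
          ∀ P : TwoPartyDP.Protocol (Fin (2 * n)) n,
            P.IsTwoPartyDP ε δ → ¬ P.Computes f β) := by
  refine ⟨?_, ?_⟩
  all_goals
    obtain ⟨c₁, hc₁, c₂, hc₂, N, hN⟩ := TwoPartyDP.exists_forall_not_computes ε₀ hε₀
    refine ⟨c₁, hc₁, c₂, hc₂, N, fun n hn => ?_⟩
    obtain ⟨D, hD, hdiv, hcomp⟩ := hN n hn
  · exact ⟨TwoPartyDP.blockInnerProduct n D, ⟨D, hD, rfl⟩,
      TwoPartyDP.hasSensitivity_blockInnerProduct (one_le_two.trans hdiv),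
      fun ε δ β _ => hcomp Bool (fun _ b => b) _ 1 (by norm_num) (fun _ _ => (one_mul _).symm)
        ε δ β⟩
  · exact ⟨TwoPartyDP.symmetricParity n D, TwoPartyDP.isSymmetric_symmetricParity,
      TwoPartyDP.hasSensitivity_symmetricParity hD hdiv,
      fun ε δ β _ => hcomp (Fin (2 * n)) TwoPartyDP.encodeBit _ (1 / 2) le_rfl
        TwoPartyDP.encodesBlockInnerProduct_symmetricParity ε δ β⟩
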